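/- Let $\Bbbk$ be a field. A \emph{commutative tri-algebra} is a vector space $A$ with bilinear operations $\ast,\bullet$ such that $\bullet$ is commutative and associative, $(x\ast y)\ast z=x\ast(y\ast z)=x\ast(z\ast y)$, $x\ast(y\bullet z)=x\ast(y\ast z)$ and $(x\bullet y)\ast z=x\bullet(y\ast z)$. A \emph{tri-dendriform algebra} is a vector space $B$ with bilinear operations $\prec,\succ,\cdot$ such that, with $x\circ y=x\prec y+x\succ y+x\cdot y$, $(x\prec y)\prec z=x\prec(y\circ z)$, $(x\succ y)\prec z=x\succ(y\prec z)$, $(x\circ y)\succ z=x\succ(y\succ z)$, $x\succ(y\cdot z)=(x\succ y)\cdot z$, $(x\prec y)\cdot z=x\cdot(y\succ z)$, $(x\cdot y)\prec z=x\cdot(y\prec z)$, $(x\cdot y)\cdot z=x\cdot(y\cdot z)$. A \emph{$B$-module} is a vector space $N$ with bilinear left and right actions $\prec,\succ,\cdot:B\times N\to N$ and $N\times B\to N$ satisfying each of these seven identities whenever exactly one of $x,y,z$ lies in $N$ and the other two lie in $B$. Let $A$ be a free commutative tri-algebra on a nonempty set, $B$ a tri-dendriform algebra and $N$ a $B$-module.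 Then $A\otimes B$ with $$(a_1\otimes b_1)(a_2\otimes b_2)=(a_1\ast a_2)\otimes(b_1\prec b_2)+(a_2\ast a_1)\otimes(b_1\succ b_2)+(a_1\bullet a_2)\otimes(b_1\cdot b_2)$$ is an associative algebra, and the same formulas make $A\otimes N$ a bimodule over it. Let $C^n_{\mathrm{Hoch}}(A\otimes B,A\otimes N)=\mathrm{Hom}((A\otimes B)^{\otimes n},A\otimes N)$, $n\ge 0$, with the Hochschild differential $\delta_{HH}$ and cohomology $HH^n(A\otimes B,A\otimes N)$. For $n\ge 0$ let $C^n_{\mathrm{tri}}(B,N)$ be the space of families $g(I;b_1,\dots,b_n)\in N$, multilinear in $b_1,\dots,b_n\in B$ and indexed by the nonempty subsets $I\subseteq\{1,\dots,n\}$ (so $C^0_{\mathrm{tri}}=0$). For nonempty $I\subseteq\{1,\dots,n+1\}$ put $$(\delta_{\mathrm{tri}}g)(I;b_1,\dots,b_{n+1})=\lambda_I+\sum_{i=1}^n(-1)^i g(\sigma_i(I);b_1,\dots,b_i\circ_{I,i}b_{i+1},\dots,b_{n+1})+(-1)^{n+1}\rho_I .$$ Here $\sigma_i:\{1,\dots,n+1\}\to\{1,\dots,n\}$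 is the monotone surjection identifying $i$ and $i+1$; $\circ_{I,i}$ is $\prec$ if $i\in I,\ i+1\notin I$, is $\succ$ if $i\notin I,\ i+1\in I$, is $\cdot$ if $i,i+1\in I$, and is $\circ$ if $i,i+1\notin I$. With $I'=\{j\in\{1,\dots,n\}: j+1\in I\}$, $\lambda_I$ is $b_1\succ g(I';b_2,\dots,b_{n+1})$ if $1\notin I$, $b_1\cdot g(I';b_2,\dots,b_{n+1})$ if $1\in I\ne\{1\}$, and $\sum_{J\neq\emptyset} b_1\prec g(J;b_2,\dots,b_{n+1})$ if $I=\{1\}$. With $I''=I\cap\{1,\dots,n\}$, $\rho_I$ is $g(I'';b_1,\dots,b_n)\prec b_{n+1}$ if $n+1\notin I$, $g(I'';b_1,\dots,b_n)\cdot b_{n+1}$ if $n+1\in I\neq\{n+1\}$, and $\sum_{J\neq\emptyset}g(J;b_1,\dots,b_n)\succ b_{n+1}$ if $I=\{n+1\}$. Then $\delta_{\mathrm{tri}}^2=0$ and $\delta_{HH}^2=0$, and there is an injective morphism of cochain complexes $\Psi:C^*_{\mathrm{tri}}(B,N)\to C^*_{\mathrm{Hoch}}(A\otimes B,A\otimes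 N)$ with $$(\Psi g)(a_1\otimes b_1,\dots,a_n\otimes b_n)=\sum_{\emptyset\ne I\subseteq\{1,\dots,n\}}P(a_1,\dots,a_n;I)\otimes g(I;b_1,\dots,b_n),$$ where $P(a_1,\dots,a_n;I)=(a_{i_1}\bullet\cdots\bullet a_{i_k})\ast(a_{j_1}\ast\cdots\ast a_{j_{n-k}})$, $i_1<\dots<i_k$ being the elements of $I$ and $j_1<\dots<j_{n-k}$ those of its complement (the second factor is omitted if $k=n$). With the quotient complex $Q^*=C^*_{\mathrm{Hoch}}(A\otimes B,A\otimes N)/\Psi(C^*_{\mathrm{tri}}(B,N))$, the sequence of complexes $$0\to C^*_{\mathrm{tri}}(B,N)\xrightarrow{\Psi}C^*_{\mathrm{Hoch}}(A\otimes B,A\otimes N)\to Q^*\to 0$$ is exact, and with $H^n_{\mathrm{tri}}(B,N)=H^n(C^*_{\mathrm{tri}}(B,N))$ the induced sequence, with its connecting homomorphisms, $$0\to H^0_{\mathrm{tri}}(B,N)\to HH^0(A\otimes B,A\otimes N)\to H^0(Q^*)\to H^1_{\mathrm{tri}}(B,N)\to\cdots\to H^n_{\mathrm{tri}}(B,N)\to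 HH^n(A\otimes B,A\otimes N)\to H^n(Q^*)\to H^{n+1}_{\mathrm{tri}}(B,N)\to\cdots$$ is exact. -/

import Mathlib

open CategoryTheory
open scoped TensorProduct

universe u v w

noncomputable section

/-! ### Commutative tri-algebras and tri-dendriform algebras -/

/-- A commutative tri-algebra over `k`: a perm product `ast` (written `∗`) and a commutative
associative product `bul` (written `•`), subject to two compatibility relations. -/
class ComTriAlgebra (k : Type v) (A : Type w) [Field k] [AddCommGroup A] [Module k A] where
  ast : A →ₗ[k] A →ₗ[k] A
  bul : A →ₗ[k] A →ₗ[k] A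
  ast_assoc : ∀ x y z, ast (ast x y) z = ast x (ast y z)
  ast_perm : ∀ x y z, ast x (ast y z) = ast x (ast z y)
  bul_comm : ∀ x y, bul x y = bul y x
  bul_assoc : ∀ x y z, bul (bul x y) z = bul x (bul y z)
  ast_bul : ∀ x y z, ast x (bul y z) = ast x (ast y z)
  bul_ast : ∀ x y z, ast (bul x y) z = bul x (ast y z)

/-- `A` is the free commutative tri-algebra on the family `ι : X → A`: every map from `X` to a
commutative tri-algebra `C` extends uniquely to a morphism `A → C`. The test algebras range over a
universe that contains (copies of) `A` and of the free commutative tri-algebra on `X`. -/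
def IsFreeComTri (k : Type v) {X : Type w} {A : Type u} [Field k] [AddCommGroup A] [Module k A]
    [ComTriAlgebra k A] (ι : X → A) : Prop :=
  ∀ (C : Type (max u v w)) [AddCommGroup C] [Module k C] [ComTriAlgebra k C] (f : X → C),
    ∃! φ : A →ₗ[k] C,
      (∀ x y, φ (ComTriAlgebra.ast (k := k) x y) = ComTriAlgebra.ast (k := k) (φ x) (φ y)) ∧
      (∀ x y, φ (ComTriAlgebra.bul (k := k) x y) = ComTriAlgebra.bul (k := k) (φ x) (φ y)) ∧
      ∀ x, φ (ι x) = f x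

/-- A tri-dendriform algebra over `k`, with operations `≺` (`prec`), `≻` (`succ`), `·` (`dot`). -/
class TriDendriform (k : Type v) (B : Type u) [Field k] [AddCommGroup B] [Module k B] where
  prec : B →ₗ[k] B →ₗ[k] B
  succ : B →ₗ[k] B →ₗ[k] B
  dot : B →ₗ[k] B →ₗ[k] B
  prec_prec : ∀ x y z, prec (prec x y) z = prec x (prec y z + succ y z + dot y z)
  succ_prec : ∀ x y z, prec (succ x y) z = succ x (prec y z)
  succ_succ : ∀ x y z, succ (prec x y + succ x y + dot x y) z = succ x (succ y z)
  succ_dot : ∀ x y z, succ x (dot y z) = dot (succ x y) z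
  prec_dot : ∀ x y z, dot (prec x y) z = dot x (succ y z)
  dot_prec : ∀ x y z, prec (dot x y) z = dot x (prec y z)
  dot_dot : ∀ x y z, dot (dot x y) z = dot x (dot y z)

/-- A module over a tri-dendriform algebra `B`: left actions `b ≺ m`, `b ≻ m`, `b · m` and right
actions `m ≺ b`, `m ≻ b`, `m · b`, satisfying each tri-dendriform identity with exactly one of the
three arguments in `N` (so that `B ⊕ N` is a tri-dendriform algebra in which `N` squares to zero).
The suffix of a law tells whether the module element stands first, second or third. -/
class TriDendModule (k : Type v) (B N : Type u) [Field k] [AddCommGroup B] [Module k B]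
    [TriDendriform k B] [AddCommGroup N] [Module k N] where
  lprec : B →ₗ[k] N →ₗ[k] N
  lsucc : B →ₗ[k] N →ₗ[k] N
  ldot : B →ₗ[k] N →ₗ[k] N
  rprec : N →ₗ[k] B →ₗ[k] N
  rsucc : N →ₗ[k] B →ₗ[k] N
  rdot : N →ₗ[k] B →ₗ[k] N
  prec_prec₁ : ∀ (m : N) (y z : B), rprec (rprec m y) z =
    rprec m (TriDendriform.prec (k := k) y z + TriDendriform.succ (k := k) y z
      + TriDendriform.dot (k := k) y z)
  prec_prec₂ : ∀ (x : B) (m : N) (z : B), rprec (lprec x m) z =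
    lprec x (rprec m z + rsucc m z + rdot m z)
  prec_prec₃ : ∀ (x y : B) (m : N), lprec (TriDendriform.prec (k := k) x y) m =
    lprec x (lprec y m + lsucc y m + ldot y m)
  succ_prec₁ : ∀ (m : N) (y z : B), rprec (rsucc m y) z =
    rsucc m (TriDendriform.prec (k := k) y z)
  succ_prec₂ : ∀ (x : B) (m : N) (z : B), rprec (lsucc x m) z = lsucc x (rprec m z)
  succ_prec₃ : ∀ (x y : B) (m : N), lprec (TriDendriform.succ (k := k) x y) m =
    lsucc x (lprec y m)
  succ_succ₁ : ∀ (m : N) (y z : B), rsucc (rprec m y + rsucc m y + rdot m y) z =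
    rsucc m (TriDendriform.succ (k := k) y z)
  succ_succ₂ : ∀ (x : B) (m : N) (z : B), rsucc (lprec x m + lsucc x m + ldot x m) z =
    lsucc x (rsucc m z)
  succ_succ₃ : ∀ (x y : B) (m : N), lsucc (TriDendriform.prec (k := k) x y
      + TriDendriform.succ (k := k) x y + TriDendriform.dot (k := k) x y) m =
    lsucc x (lsucc y m)
  succ_dot₁ : ∀ (m : N) (y z : B), rsucc m (TriDendriform.dot (k := k) y z) =
    rdot (rsucc m y) z
  succ_dot₂ : ∀ (x : B) (m : N) (z : B), lsucc x (rdot m z) = rdot (lsucc x m) z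
  succ_dot₃ : ∀ (x y : B) (m : N), lsucc x (ldot y m) =
    ldot (TriDendriform.succ (k := k) x y) m
  prec_dot₁ : ∀ (m : N) (y z : B), rdot (rprec m y) z =
    rdot m (TriDendriform.succ (k := k) y z)
  prec_dot₂ : ∀ (x : B) (m : N) (z : B), rdot (lprec x m) z = ldot x (rsucc m z)
  prec_dot₃ : ∀ (x y : B) (m : N), ldot (TriDendriform.prec (k := k) x y) m =
    ldot x (lsucc y m)
  dot_prec₁ : ∀ (m : N) (y z : B), rprec (rdot m y) z =
    rdot m (TriDendriform.prec (k := k) y z)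
  dot_prec₂ : ∀ (x : B) (m : N) (z : B), rprec (ldot x m) z = ldot x (rprec m z)
  dot_prec₃ : ∀ (x y : B) (m : N), lprec (TriDendriform.dot (k := k) x y) m =
    ldot x (lprec y m)
  dot_dot₁ : ∀ (m : N) (y z : B), rdot (rdot m y) z = rdot m (TriDendriform.dot (k := k) y z)
  dot_dot₂ : ∀ (x : B) (m : N) (z : B), rdot (ldot x m) z = ldot x (rdot m z)
  dot_dot₃ : ∀ (x y : B) (m : N), ldot (TriDendriform.dot (k := k) x y) m =
    ldot x (ldot y m)

/-! ### Elementary operations on multilinear cochains -/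

section Cochains

variable {k : Type v} [Field k] {V W : Type u} [AddCommGroup V] [Module k V]
  [AddCommGroup W] [Module k W]

/-- `f ↦ ((x₀, …, xₙ) ↦ l x₀ (f (x₁, …, xₙ)))`. -/
def headMap (l : V →ₗ[k] W →ₗ[k] W) (n : ℕ) :
    MultilinearMap k (fun _ : Fin n => V) W →ₗ[k]
      MultilinearMap k (fun _ : Fin (n + 1) => V) W where
  toFun f := MultilinearMap.mk' (fun x => l (x 0) (f (fun j => x j.succ)))
    (fun m i x y => by
      cases i using Fin.cases with
      | zero => simp
      | succ i =>
        have h : ∀ z : V, (fun j : Fin n => Function.update m i.succ z j.succ) =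
            Function.update (fun j => m j.succ) i z := fun z => by
          ext j; simp [Function.update_apply]
        simp [h, Ne.symm])
    (fun m i c x => by
      cases i using Fin.cases with
      | zero => simp
      | succ i =>
        have h : ∀ z : V, (fun j : Fin n => Function.update m i.succ z j.succ) =
            Function.update (fun j => m j.succ) i z := fun z => by
          ext j; simp [Function.update_apply]
        simp [h, Ne.symm])
  map_add' f g := by ext x; simp
  map_smul' c f := by ext x; simp

/-- `f ↦ ((x₀, …, xₙ) ↦ r (f (x₀, …, xₙ₋₁)) xₙ)`. -/
def lastMap (r : W →ₗ[k] V →ₗ[k] W) (n : ℕ) :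
    MultilinearMap k (fun _ : Fin n => V) W →ₗ[k]
      MultilinearMap k (fun _ : Fin (n + 1) => V) W where
  toFun f := MultilinearMap.mk' (fun x => r (f (fun j => x j.castSucc)) (x (Fin.last n)))
    (fun m i x y => by
      cases i using Fin.lastCases with
      | last => simp
      | cast i =>
        have h : ∀ z : V, (fun j : Fin n => Function.update m i.castSucc z j.castSucc) =
            Function.update (fun j => m j.castSucc) i z := fun z => by
          ext j; simp [Function.update_apply]
        simp [h, Ne.symm])
    (fun m i c x => by
      cases i using Fin.lastCases with
      | last => simp
      | cast i =>
        have h : ∀ z : V, (fun j : Fin n => Function.update m i.castSucc z j.castSucc) =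
            Function.update (fun j => m j.castSucc) i z := fun z => by
          ext j; simp [Function.update_apply]
        simp [h, Ne.symm])
  map_add' f g := by ext x; simp
  map_smul' c f := by ext x; simp

/-- `(x₀, …, xₙ) ↦ (x₀, …, xᵢ₋₁, μ xᵢ xᵢ₊₁, xᵢ₊₂, …, xₙ)`. -/
def mergeAt (μ : V →ₗ[k] V →ₗ[k] V) {n : ℕ} (i : Fin n) (x : Fin (n + 1) → V) : Fin n → V :=
  fun j => if j < i then x j.castSucc
    else if j = i then μ (x i.castSucc) (x i.succ)
    else x j.succ

theorem mergeAt_update (μ : V →ₗ[k] V →ₗ[k] V) {n : ℕ} (i : Fin n) (m : Fin (n + 1) → V)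
    (j : Fin (n + 1)) :
    ∃ (j' : Fin n) (L : V →ₗ[k] V),
      ∀ z, mergeAt μ i (Function.update m j z) = Function.update (mergeAt μ i m) j' (L z) := by
  rcases lt_trichotomy j i.castSucc with h | h | h
  · have hj : (j : ℕ) < n := by have := i.2; simp [Fin.lt_def] at h; omega
    refine ⟨⟨j, hj⟩, LinearMap.id, fun z => funext fun l => ?_⟩
    simp only [mergeAt, Function.update_apply, Fin.ext_iff, Fin.lt_def, Fin.val_castSucc,
      Fin.val_succ, LinearMap.id_apply] at h ⊢
    split_ifs <;> first | rfl | omega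
  · subst h
    refine ⟨i, μ.flip (m i.succ), fun z => funext fun l => ?_⟩
    simp only [mergeAt, Function.update_apply, Fin.ext_iff, Fin.lt_def, Fin.val_castSucc,
      Fin.val_succ, LinearMap.flip_apply]
    split_ifs <;> first | rfl | omega
  · by_cases h' : j = i.succ
    · subst h'
      refine ⟨i, μ (m i.castSucc), fun z => funext fun l => ?_⟩
      simp only [mergeAt, Function.update_apply, Fin.ext_iff, Fin.lt_def, Fin.val_castSucc,
        Fin.val_succ]
      split_ifs <;> first | rfl | omega
    · have hj : (j : ℕ) - 1 < n := by have := i.2; have := j.2; omega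
      refine ⟨⟨j - 1, hj⟩, LinearMap.id, fun z => funext fun l => ?_⟩
      simp only [mergeAt, Function.update_apply, Fin.ext_iff, Fin.lt_def, Fin.val_castSucc,
        Fin.val_succ, LinearMap.id_apply] at h h' ⊢
      split_ifs <;> first | rfl | omega

/-- `f ↦ ((x₀, …, xₙ) ↦ f (x₀, …, xᵢ₋₁, μ xᵢ xᵢ₊₁, xᵢ₊₂, …, xₙ))`. -/
def mergeMap (μ : V →ₗ[k] V →ₗ[k] V) {n : ℕ} (i : Fin n) :
    MultilinearMap k (fun _ : Fin n => V) W →ₗ[k]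
      MultilinearMap k (fun _ : Fin (n + 1) => V) W where
  toFun f := MultilinearMap.mk' (fun x => f (mergeAt μ i x))
    (fun m j x y => by
      obtain ⟨j', L, h⟩ := mergeAt_update μ i m j
      simp only [h, map_add, MultilinearMap.map_update_add])
    (fun m j c x => by
      obtain ⟨j', L, h⟩ := mergeAt_update μ i m j
      simp only [h, map_smul, MultilinearMap.map_update_smul])
  map_add' f g := by ext x; simp
  map_smul' c f := by ext x; simp

/-! ### The Hochschild complex -/

/-- `μ` is an associative product on `V`, and `l`, `r` make `W` a bimodule over it. -/
def IsAssocBimodule (μ : V →ₗ[k] V →ₗ[k] V) (l : V →ₗ[k] W →ₗ[k] W)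
    (r : W →ₗ[k] V →ₗ[k] W) : Prop :=
  (∀ x y z, μ (μ x y) z = μ x (μ y z)) ∧
  (∀ x y m, l (μ x y) m = l x (l y m)) ∧
  (∀ x m y, r (l x m) y = l x (r m y)) ∧
  (∀ m x y, r (r m x) y = r m (μ x y))

/-- The Hochschild differential of the (not necessarily unital) algebra `(V, μ)` with coefficients
in the bimodule `(W, l, r)`, on `n`-cochains `Hom(V^{⊗n}, W)`, `n ≥ 0`:
`x₁ f(x₂, …) + ∑ᵢ (-1)ⁱ f(…, xᵢ xᵢ₊₁, …) + (-1)ⁿ⁺¹ f(x₁, …, xₙ) xₙ₊₁`. -/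
def hochD (μ : V →ₗ[k] V →ₗ[k] V) (l : V →ₗ[k] W →ₗ[k] W) (r : W →ₗ[k] V →ₗ[k] W) (n : ℕ) :
    MultilinearMap k (fun _ : Fin n => V) W →ₗ[k]
      MultilinearMap k (fun _ : Fin (n + 1) => V) W :=
  headMap l n + ∑ i : Fin n, (-1 : k) ^ ((i : ℕ) + 1) • mergeMap μ i
    + (-1 : k) ^ (n + 1) • lastMap r n

/-- The Hochschild cochain complex. -/
def hochComplex (μ : V →ₗ[k] V →ₗ[k] V) (l : V →ₗ[k] W →ₗ[k] W) (r : W →ₗ[k] V →ₗ[k] W)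
    (h : ∀ n, hochD μ l r (n + 1) ∘ₗ hochD μ l r n = 0) :
    CochainComplex (ModuleCat.{u} k) ℕ :=
  CochainComplex.of (fun n => ModuleCat.of k (MultilinearMap k (fun _ : Fin n => V) W))
    (fun n => ModuleCat.ofHom (hochD μ l r n))
    (fun n => by rw [← ModuleCat.ofHom_comp, h]; rfl)

end Cochains

/-! ### The tri-dendriform complex -/

/-- The nonempty subsets of `{1, …, n}` (here: of `Fin n`). -/
abbrev NonemptySubset (n : ℕ) : Type := {I : Finset (Fin n) // I.Nonempty}

section Tri

variable (k : Type v) [Field k] (B N : Type u) [AddCommGroup B] [Module k B] [TriDendriform k B]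
  [AddCommGroup N] [Module k N] [TriDendModule k B N]

/-- Tri-dendriform `n`-cochains: families `g(I; b₁, …, bₙ) ∈ N`, multilinear in the `bᵢ`, indexed by
the nonempty subsets `I` of `{1, …, n}`. In particular there are no nonzero `0`-cochains. -/
abbrev TriCochain (n : ℕ) : Type u :=
  NonemptySubset n → MultilinearMap k (fun _ : Fin n => B) N

variable {B} in
/-- The product of `bᵢ` and `bᵢ₊₁` used for the index set `I`: `≺` if only `i` lies in `I`, `≻` if
only `i + 1` does, `·` if both do, and `≺ + ≻ + ·` if neither does. -/
def innerOp {n : ℕ} (I : Finset (Fin (n + 1))) (i : Fin n) : B →ₗ[k] B →ₗ[k] B :=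
  if i.castSucc ∈ I then
    if i.succ ∈ I then TriDendriform.dot else TriDendriform.prec
  else
    if i.succ ∈ I then TriDendriform.succ
    else TriDendriform.prec + TriDendriform.succ + TriDendriform.dot

/-- The image of `I` under the monotone surjection `{1, …, n+1} → {1, …, n}` that identifies `i` and
`i + 1`. -/
def collapse {n : ℕ} (I : NonemptySubset (n + 1)) (i : Fin n) : NonemptySubset n :=
  ⟨I.1.image i.predAbove, I.2.image _⟩

/-- The first term of the differential at `I`: with `I' = {j : j + 1 ∈ I}` it is
`b₁ · g(I'; b₂, …)` if `1 ∈ I ≠ {1}`, it is `b₁ ≻ g(I'; b₂, …)` if `1 ∉ I`, and it is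
`∑_J b₁ ≺ g(J; b₂, …)` over all nonempty `J` if `I = {1}`. -/
def triHead {n : ℕ} (g : TriCochain k B N n) (I : NonemptySubset (n + 1)) :
    MultilinearMap k (fun _ : Fin (n + 1) => B) N :=
  if h : (Finset.univ.filter fun j : Fin n => j.succ ∈ I.1).Nonempty then
    if 0 ∈ I.1 then headMap TriDendModule.ldot n (g ⟨_, h⟩)
    else headMap TriDendModule.lsucc n (g ⟨_, h⟩)
  else ∑ J, headMap TriDendModule.lprec n (g J)

/-- The last term of the differential at `I`, up to sign: with `I' = I ∩ {1, …, n}` it is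
`g(I'; b₁, …, bₙ) · bₙ₊₁` if `n + 1 ∈ I ≠ {n + 1}`, it is `g(I'; b₁, …, bₙ) ≺ bₙ₊₁` if
`n + 1 ∉ I`, and it is `∑_J g(J; b₁, …, bₙ) ≻ bₙ₊₁` over all nonempty `J` if `I = {n + 1}`. -/
def triLast {n : ℕ} (g : TriCochain k B N n) (I : NonemptySubset (n + 1)) :
    MultilinearMap k (fun _ : Fin (n + 1) => B) N :=
  if h : (Finset.univ.filter fun j : Fin n => j.castSucc ∈ I.1).Nonempty then
    if Fin.last n ∈ I.1 then lastMap TriDendModule.rdot n (g ⟨_, h⟩)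
    else lastMap TriDendModule.rprec n (g ⟨_, h⟩)
  else ∑ J, lastMap TriDendModule.rsucc n (g J)

/-- The tri-dendriform differential. -/
def triD (n : ℕ) : TriCochain k B N n →ₗ[k] TriCochain k B N (n + 1) where
  toFun g I := triHead k B N g I
    + ∑ i : Fin n, (-1 : k) ^ ((i : ℕ) + 1) • mergeMap (innerOp k I.1 i) i (g (collapse I i))
    + (-1 : k) ^ (n + 1) • triLast k B N g I
  map_add' f g := by
    funext I
    have h1 : triHead k B N (f + g) I = triHead k B N f I + triHead k B N g I := by
      unfold triHead; split_ifs <;> simp [Finset.sum_add_distrib]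
    have h2 : triLast k B N (f + g) I = triLast k B N f I + triLast k B N g I := by
      unfold triLast; split_ifs <;> simp [Finset.sum_add_distrib]
    simp only [h1, h2, Pi.add_apply, map_add, smul_add, Finset.sum_add_distrib]
    abel
  map_smul' c f := by
    funext I
    have h1 : triHead k B N (c • f) I = c • triHead k B N f I := by
      unfold triHead; split_ifs <;> simp [Finset.smul_sum]
    have h2 : triLast k B N (c • f) I = c • triLast k B N f I := by
      unfold triLast; split_ifs <;> simp [Finset.smul_sum]
    simp only [h1, h2, Pi.smul_apply, map_smul, smul_add, Finset.smul_sum, RingHom.id_apply,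
      smul_comm c]

/-- The tri-dendriform cochain complex. -/
def triComplex (h : ∀ n, triD k B N (n + 1) ∘ₗ triD k B N n = 0) :
    CochainComplex (ModuleCat.{u} k) ℕ :=
  CochainComplex.of (fun n => ModuleCat.of k (TriCochain k B N n))
    (fun n => ModuleCat.ofHom (triD k B N n))
    (fun n => by rw [← ModuleCat.ofHom_comp, h]; rfl)

end Tri

/-! ### Tensor products and the embedding -/

section Tensor

variable (k : Type v) [Field k] (A : Type u) [AddCommGroup A] [Module k A] [ComTriAlgebra k A]

/-- From bilinear operations `p, s, d` (playing the roles of `≺, ≻, ·`) the operation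
`(a ⊗ y)(a' ⊗ z) = (a ∗ a') ⊗ p y z + (a' ∗ a) ⊗ s y z + (a • a') ⊗ d y z`. -/
def tensorOp {Y Z T : Type u} [AddCommGroup Y] [Module k Y] [AddCommGroup Z] [Module k Z]
    [AddCommGroup T] [Module k T] (p s d : Y →ₗ[k] Z →ₗ[k] T) :
    A ⊗[k] Y →ₗ[k] A ⊗[k] Z →ₗ[k] A ⊗[k] T :=
  TensorProduct.map₂ ComTriAlgebra.ast p + TensorProduct.map₂ ComTriAlgebra.ast.flip s
    + TensorProduct.map₂ ComTriAlgebra.bul d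

variable (B N : Type u) [AddCommGroup B] [Module k B] [TriDendriform k B]
  [AddCommGroup N] [Module k N] [TriDendModule k B N]

/-- The product of `A ⊗ B`. -/
def tensorMul : A ⊗[k] B →ₗ[k] A ⊗[k] B →ₗ[k] A ⊗[k] B :=
  tensorOp k A TriDendriform.prec TriDendriform.succ TriDendriform.dot

/-- The left action of `A ⊗ B` on `A ⊗ N`. -/
def tensorLeft : A ⊗[k] B →ₗ[k] A ⊗[k] N →ₗ[k] A ⊗[k] N :=
  tensorOp k A TriDendModule.lprec TriDendModule.lsucc TriDendModule.ldot

/-- The right action of `A ⊗ B` on `A ⊗ N`. -/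
def tensorRight : A ⊗[k] N →ₗ[k] A ⊗[k] B →ₗ[k] A ⊗[k] N :=
  tensorOp k A TriDendModule.rprec TriDendModule.rsucc TriDendModule.rdot

variable {A}

/-- The product `x₁ x₂ ⋯ xₘ` of a nonempty list (junk value `0` on the empty list). -/
def listProd (μ : A →ₗ[k] A →ₗ[k] A) : List A → A
  | [] => 0
  | x :: xs => xs.foldl (fun p y => μ p y) x

/-- `P(a₁, …, aₙ; I) = (a_{i₁} • ⋯ • a_{iₖ}) ∗ (a_{j₁} ∗ ⋯ ∗ a_{jₙ₋ₖ})` where `i₁ < ⋯ < iₖ` are the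
elements of `I` and `j₁ < ⋯ < jₙ₋ₖ` those of its complement; the second factor is omitted if the
complement is empty. -/
def pElem {n : ℕ} (a : Fin n → A) (I : NonemptySubset n) : A :=
  let u := listProd k ComTriAlgebra.bul (((List.finRange n).filter (· ∈ I.1)).map a)
  if I.1 = Finset.univ then u
  else ComTriAlgebra.ast (k := k) u
    (listProd k ComTriAlgebra.ast (((List.finRange n).filter (· ∉ I.1)).map a))

end Tensor

/-! ### The quotient of a complex by the image of a morphism -/

section Quotient

variable {k : Type v} [Field k] {K L : CochainComplex (ModuleCat.{u} k) ℕ} (f : K ⟶ L)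

/-- The quotient complex `L / f(K)`. -/
def quotComplex : CochainComplex (ModuleCat.{u} k) ℕ where
  X n := ModuleCat.of k (L.X n ⧸ LinearMap.range (f.f n).hom)
  d i j := ModuleCat.ofHom (Submodule.mapQ _ _ (L.d i j).hom (by
    rintro _ ⟨x, rfl⟩
    refine ⟨(K.d i j).hom x, ?_⟩
    exact (LinearMap.congr_fun (congrArg ModuleCat.Hom.hom (f.comm i j)) x).symm))
  shape i j hij := by
    ext x
    simp [L.shape i j hij]
  d_comp_d' i j l _ _ := by
    ext x
    exact congrArg (Submodule.mkQ (LinearMap.range (f.f l).hom))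
      (LinearMap.congr_fun (congrArg ModuleCat.Hom.hom (L.d_comp_d i j l)) x)

/-- The projection `L → L / f(K)`. -/
def quotProj : L ⟶ quotComplex f where
  f n := ModuleCat.ofHom (Submodule.mkQ _)
  comm' i j _ := by
    ext x
    rfl

/-- The sequence `K → L → L / f(K)` of complexes. -/
def quotSequence : ShortComplex (CochainComplex (ModuleCat.{u} k) ℕ) :=
  ShortComplex.mk f (quotProj f) (by
    ext n x
    exact (Submodule.Quotient.mk_eq_zero _).2 ⟨x, rfl⟩)

end Quotient

end

/-! ### The tensor product of a commutative tri-algebra and a tri-dendriform algebra -/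

section TensorAssoc

variable {k : Type v} [Field k] {A : Type u} [AddCommGroup A] [Module k A] [ComTriAlgebra k A]

/-! Everything rests on a normal form for products in a commutative tri-algebra: a product of `n`
elements depends only on which nonempty set `I` of factors is not starred, and its value is `P(a;
I)`. To make this usable, `ComTriAlgebra.exists_embedding` embeds `A` by a linear map `j` into a
commutative algebra `U` carrying a second linear map `e`, multiplicative for both products, with `j
(x • y) = j x * j y` and `j (x ∗ y) = j x * e y`. By `map_pElem`, `j` sends `P(a; I)` to the product
of the `j (a i)` over `I` and the `e (a i)` off `I`. Multilinearity of `P` and all its identities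
are then comparisons of commutative products.

The map `Ψ` commutes with the differentials (`hochD_comp_psi`) because each Hochschild term,
evaluated on pure tensors, expands in the `P(a; I)` with the corresponding term of the
tri-dendriform differential as coefficient. Outer terms split the index sets according to their
trace at the first or last index; an inner term groups them by their image under `σᵢ`.

Freeness serves only for injectivity (`psi_injective`). It yields a morphism from `A` to
polynomials, with `x ∗ y = y(1) x`, sending a generator to the variable. For suitable `aᵢ` the `P(a;
I)` go to distinct monomials, by uniqueness of binary expansions, so `g(I; -)` can be read off from
`Ψ g`.

The square of the tri-dendriform differential is never computed: it vanishes because `Ψ` is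
injective and the Hochschild differential squares to zero. The long exact sequence is that of a
short exact sequence of complexes, and its initial zero comes from the absence of nonzero
tri-dendriform `0`-cochains. -/

theorem tensorOp_tmul {Y Z T : Type u} [AddCommGroup Y] [Module k Y] [AddCommGroup Z] [Module k Z]
    [AddCommGroup T] [Module k T] (p s d : Y →ₗ[k] Z →ₗ[k] T) (a a' : A) (y : Y) (z : Z) :
    tensorOp k A p s d (a ⊗ₜ y) (a' ⊗ₜ z) =
      ComTriAlgebra.ast (k := k) a a' ⊗ₜ p y z + ComTriAlgebra.ast (k := k) a' a ⊗ₜ s y z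
        + ComTriAlgebra.bul (k := k) a a' ⊗ₜ d y z := by
  simp [tensorOp]

/-- Associativity of the operations `tensorOp` built from heterogeneous operations that satisfy the
seven tri-dendriform identities. -/
theorem tensorOp_assoc {Y Z W P Q T : Type u} [AddCommGroup Y] [Module k Y] [AddCommGroup Z]
    [Module k Z] [AddCommGroup W] [Module k W] [AddCommGroup P] [Module k P] [AddCommGroup Q]
    [Module k Q] [AddCommGroup T] [Module k T]
    (p₁ s₁ d₁ : Y →ₗ[k] Z →ₗ[k] P) (p₂ s₂ d₂ : P →ₗ[k] W →ₗ[k] T)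
    (p₃ s₃ d₃ : Z →ₗ[k] W →ₗ[k] Q) (p₄ s₄ d₄ : Y →ₗ[k] Q →ₗ[k] T)
    (hpp : ∀ x y z, p₂ (p₁ x y) z = p₄ x (p₃ y z + s₃ y z + d₃ y z))
    (hsp : ∀ x y z, p₂ (s₁ x y) z = s₄ x (p₃ y z))
    (hss : ∀ x y z, s₂ (p₁ x y + s₁ x y + d₁ x y) z = s₄ x (s₃ y z))
    (hsd : ∀ x y z, s₄ x (d₃ y z) = d₂ (s₁ x y) z)
    (hpd : ∀ x y z, d₂ (p₁ x y) z = d₄ x (s₃ y z))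
    (hdp : ∀ x y z, p₂ (d₁ x y) z = d₄ x (p₃ y z))
    (hdd : ∀ x y z, d₂ (d₁ x y) z = d₄ x (d₃ y z))
    (x : A ⊗[k] Y) (y : A ⊗[k] Z) (z : A ⊗[k] W) :
    tensorOp k A p₂ s₂ d₂ (tensorOp k A p₁ s₁ d₁ x y) z =
      tensorOp k A p₄ s₄ d₄ x (tensorOp k A p₃ s₃ d₃ y z) := by
  induction x with
  | zero => simp
  | add x x' hx hx' => simp only [map_add, LinearMap.add_apply, hx, hx']
  | tmul a b =>
  induction y with
  | zero => simp
  | add x x' hx hx' => simp only [map_add, LinearMap.add_apply, hx, hx']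
  | tmul a' b' =>
  induction z with
  | zero => simp
  | add x x' hx hx' => simp only [map_add, hx, hx']
  | tmul a'' b'' =>
    -- Products of `a`, `a'`, `a''` take seven normal forms, one for each nonempty set of unstarred
    -- factors. Comparing the coefficients of each form gives exactly the seven hypotheses; the `qᵢ`
    -- identify the different spellings of one form.
    have e₁ := ComTriAlgebra.ast_assoc (k := k) (A := A)
    have e₂ := ComTriAlgebra.ast_perm (k := k) (A := A)
    have e₃ := ComTriAlgebra.bul_comm (k := k) (A := A)
    have e₄ := ComTriAlgebra.bul_assoc (k := k) (A := A)
    have e₅ := ComTriAlgebra.ast_bul (k := k) (A := A)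
    have e₆ := ComTriAlgebra.bul_ast (k := k) (A := A)
    have q₁ : ComTriAlgebra.ast (k := k) a (ComTriAlgebra.ast (k := k) a'' a') =
        ComTriAlgebra.ast (k := k) a (ComTriAlgebra.ast (k := k) a' a'') := e₂ _ _ _
    have q₂ : ComTriAlgebra.ast (k := k) a'' (ComTriAlgebra.ast (k := k) a' a) =
        ComTriAlgebra.ast (k := k) a'' (ComTriAlgebra.ast (k := k) a a') := e₂ _ _ _
    have q₃ : ComTriAlgebra.ast (k := k) a' (ComTriAlgebra.ast (k := k) a'' a) =
        ComTriAlgebra.ast (k := k) a' (ComTriAlgebra.ast (k := k) a a'') := e₂ _ _ _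
    have q₄ : ComTriAlgebra.ast (k := k) (ComTriAlgebra.bul (k := k) a' a'') a =
        ComTriAlgebra.bul (k := k) (ComTriAlgebra.ast (k := k) a' a) a'' := by
      rw [e₃ a' a'', e₆, e₃]
    have q₅ : ComTriAlgebra.bul (k := k) (ComTriAlgebra.ast (k := k) a a') a'' =
        ComTriAlgebra.bul (k := k) a (ComTriAlgebra.ast (k := k) a'' a') := by
      rw [← e₆, e₃ a a'', e₆, e₃]
    have h₁ := hpp b b' b''
    have h₃ := hss b b' b''
    simp only [map_add, LinearMap.add_apply] at h₁ h₃
    simp only [tensorOp_tmul, map_add, LinearMap.add_apply, e₁, e₄, e₅, e₆, q₁, q₂, q₃, q₅, h₁,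
      ← h₃, hsp, hsd, hpd, hdp, hdd, TensorProduct.tmul_add]
    rw [← e₆ a' a'' a, q₄]
    abel

variable (A) in
theorem isAssocBimodule_tensor (B N : Type u) [AddCommGroup B] [Module k B] [TriDendriform k B]
    [AddCommGroup N] [Module k N] [TriDendModule k B N] :
    IsAssocBimodule (tensorMul k A B) (tensorLeft k A B N) (tensorRight k A B N) := by
  open TriDendriform TriDendModule in
  refine ⟨fun x y z => tensorOp_assoc _ _ _ _ _ _ _ _ _ _ _ _ ?_ ?_ ?_ ?_ ?_ ?_ ?_ x y z,
    fun x y z => tensorOp_assoc _ _ _ _ _ _ _ _ _ _ _ _ ?_ ?_ ?_ ?_ ?_ ?_ ?_ x y z,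
    fun x y z => tensorOp_assoc _ _ _ _ _ _ _ _ _ _ _ _ ?_ ?_ ?_ ?_ ?_ ?_ ?_ x y z,
    fun x y z => tensorOp_assoc _ _ _ _ _ _ _ _ _ _ _ _ ?_ ?_ ?_ ?_ ?_ ?_ ?_ x y z⟩
  exacts [prec_prec, succ_prec, succ_succ, succ_dot, prec_dot, dot_prec, dot_dot,
    prec_prec₃, succ_prec₃, succ_succ₃, succ_dot₃, prec_dot₃, dot_prec₃, dot_dot₃,
    prec_prec₂, succ_prec₂, succ_succ₂, succ_dot₂, prec_dot₂, dot_prec₂, dot_dot₂,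
    prec_prec₁, succ_prec₁, succ_succ₁, succ_dot₁, prec_dot₁, dot_prec₁, dot_dot₁]

end TensorAssoc

/-! ### The Hochschild differential squares to zero -/

section Hochschild

variable {k : Type v} [Field k]

/-- The alternating sum of maps satisfying the coface identities squares to zero. -/
theorem alternatingSum_comp_eq_zero {U V W : Type*} [AddCommGroup U] [Module k U]
    [AddCommGroup V] [Module k V] [AddCommGroup W] [Module k W] (n : ℕ)
    (d : Fin (n + 2) → U →ₗ[k] V) (D : Fin (n + 3) → V →ₗ[k] W)
    (h : ∀ i j : Fin (n + 2), i ≤ j → D j.succ ∘ₗ d i = D i.castSucc ∘ₗ d j) :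
    (∑ j : Fin (n + 3), (-1 : k) ^ (j : ℕ) • D j) ∘ₗ
      (∑ i : Fin (n + 2), (-1 : k) ^ (i : ℕ) • d i) = 0 := by
  have expand : (∑ j : Fin (n + 3), (-1 : k) ^ (j : ℕ) • D j) ∘ₗ
      (∑ i : Fin (n + 2), (-1 : k) ^ (i : ℕ) • d i) =
      ∑ p : Fin (n + 2) × Fin (n + 3), ((-1 : k) ^ ((p.1 : ℕ) + p.2)) • (D p.2 ∘ₗ d p.1) := by
    rw [Fintype.sum_prod_type]
    ext x
    simp only [LinearMap.comp_apply, LinearMap.sum_apply, LinearMap.smul_apply, map_sum, map_smul,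
      Finset.smul_sum, smul_smul, pow_add]
  rw [expand]
  let S : Finset (Fin (n + 2) × Fin (n + 3)) := {p | (p.2 : ℕ) ≤ (p.1 : ℕ)}
  rw [← Finset.sum_add_sum_compl S, ← eq_neg_iff_add_eq_zero, ← Finset.sum_neg_distrib]
  refine Finset.sum_bij (fun p hp => (Fin.castLT p.2
    (lt_of_le_of_lt (Finset.mem_filter.mp hp).right (Fin.is_lt p.1)), p.1.succ)) ?_ ?_ ?_ ?_
  · rintro ⟨i, j⟩ hij
    simp only [S, Finset.compl_filter, Finset.mem_filter_univ, Fin.val_succ,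
      Fin.val_castLT] at hij ⊢
    omega
  · rintro ⟨i, j⟩ hij ⟨i', j'⟩ hij' h
    simp only [Prod.mk.injEq, Fin.ext_iff, Fin.val_castLT, Fin.val_succ] at h ⊢
    omega
  · rintro ⟨i, j⟩ hij
    simp only [S, Finset.compl_filter, Finset.mem_filter_univ, not_le] at hij
    refine ⟨(⟨j - 1, by omega⟩, i.castSucc), ?_, ?_⟩
    · simp only [S, Finset.mem_filter_univ, Fin.val_castSucc]
      omega
    · simp only [Prod.mk.injEq, Fin.ext_iff, Fin.val_castLT, Fin.val_succ, Fin.val_castSucc,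
        true_and]
      omega
  · rintro ⟨i, j⟩ hij
    simp only [S, Finset.mem_filter_univ] at hij
    have hj : (j : ℕ) < n + 2 := by omega
    have := h ⟨j, hj⟩ i hij
    have hc : Fin.castSucc ⟨(j : ℕ), hj⟩ = j := rfl
    rw [hc] at this
    change _ = -((-1 : k) ^ ((j : ℕ) + ((i : ℕ) + 1)) • (D i.succ ∘ₗ d ⟨j, hj⟩))
    rw [this, ← neg_smul]
    congr 1
    ring

/-! ### Coface maps of the Hochschild differential. -/

variable {V W : Type u} [AddCommGroup V] [Module k V] [AddCommGroup W] [Module k W]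
  (μ : V →ₗ[k] V →ₗ[k] V) (l : V →ₗ[k] W →ₗ[k] W) (r : W →ₗ[k] V →ₗ[k] W)

@[simp]
theorem headMap_apply (n : ℕ) (f : MultilinearMap k (fun _ : Fin n => V) W)
    (x : Fin (n + 1) → V) : headMap l n f x = l (x 0) (f fun j => x j.succ) := rfl

@[simp]
theorem lastMap_apply (n : ℕ) (f : MultilinearMap k (fun _ : Fin n => V) W)
    (x : Fin (n + 1) → V) :
    lastMap r n f x = r (f fun j => x j.castSucc) (x (Fin.last n)) := rfl

@[simp]
theorem mergeMap_apply {n : ℕ} (i : Fin n) (f : MultilinearMap k (fun _ : Fin n => V) W)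
    (x : Fin (n + 1) → V) : mergeMap μ i f x = f (mergeAt μ i x) := rfl

/-- The coface maps whose alternating sum is the Hochschild differential. -/
def hochFace (n : ℕ) (i : Fin (n + 2)) : MultilinearMap k (fun _ : Fin n => V) W →ₗ[k]
      MultilinearMap k (fun _ : Fin (n + 1) => V) W :=
  Fin.cases (headMap l n) (fun i => Fin.lastCases (lastMap r n) (fun i => mergeMap μ i) i) i

@[simp]
theorem hochFace_zero (n : ℕ) : hochFace μ l r n 0 = headMap l n := rfl

theorem hochFace_of_val_eq_last {n : ℕ} {i : Fin (n + 2)} (h : (i : ℕ) = n + 1) :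
    hochFace μ l r n i = lastMap r n := by
  obtain rfl : i = (Fin.last n).succ := Fin.ext h
  simp only [hochFace, Fin.cases_succ, Fin.lastCases_last]

theorem hochFace_of_val_eq_succ {n : ℕ} {i : Fin (n + 2)} (m : Fin n) (h : (i : ℕ) = m + 1) :
    hochFace μ l r n i = mergeMap μ m := by
  obtain rfl : i = m.castSucc.succ := Fin.ext h
  simp only [hochFace, Fin.cases_succ, Fin.lastCases_castSucc]

theorem hochD_eq_sum (n : ℕ) :
    hochD μ l r n = ∑ i : Fin (n + 2), (-1 : k) ^ (i : ℕ) • hochFace μ l r n i := by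
  rw [Fin.sum_univ_succ, Fin.sum_univ_castSucc, 
    hochFace_of_val_eq_last μ l r (i := (Fin.last n).succ) (by simp)]
  simp only [fun i : Fin n => hochFace_of_val_eq_succ μ l r (i := i.castSucc.succ) i rfl]
  simp [hochD, add_assoc]

variable {μ}

theorem mergeAt_of_lt {n : ℕ} {i j : Fin n} (h : (j : ℕ) < i) (x : Fin (n + 1) → V) :
    mergeAt μ i x j = x j.castSucc := if_pos h

theorem mergeAt_self {n : ℕ} (i : Fin n) (x : Fin (n + 1) → V) :
    mergeAt μ i x i = μ (x i.castSucc) (x i.succ) := by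
  simp [mergeAt]

theorem mergeAt_of_gt {n : ℕ} {i j : Fin n} (h : (i : ℕ) < j) (x : Fin (n + 1) → V) :
    mergeAt μ i x j = x j.succ := by
  simp [mergeAt, (Fin.lt_def.2 h).ne', (Fin.lt_def.2 h).not_gt]

/-- The two merged pairs are disjoint, so no associativity is needed. -/
theorem mergeAt_mergeAt_of_lt {n : ℕ} {i j : Fin n} (hij : (i : ℕ) < j) (x : Fin (n + 2) → V) :
    mergeAt μ i (mergeAt μ j.succ x) = mergeAt μ j (mergeAt μ i.castSucc x) := by
  funext m
  rcases lt_trichotomy (m : ℕ) i with h | h | h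
  · rw [mergeAt_of_lt h, mergeAt_of_lt (by simp; omega), mergeAt_of_lt (by omega),
      mergeAt_of_lt (by simpa using h)]
  · obtain rfl := Fin.ext h
    rw [mergeAt_self, mergeAt_of_lt (by simp; omega), mergeAt_of_lt (by simp; omega),
      mergeAt_of_lt hij, mergeAt_self, Fin.castSucc_succ]
  · rw [mergeAt_of_gt h]
    rcases lt_trichotomy (m : ℕ) j with h' | h' | h'
    · rw [mergeAt_of_lt (by simpa using h'), mergeAt_of_lt h', mergeAt_of_gt (by simpa using h),
        Fin.castSucc_succ]
    · obtain rfl := Fin.ext h'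
      rw [mergeAt_self, mergeAt_self, mergeAt_of_gt (by simpa using hij),
        mergeAt_of_gt (by simp; omega), Fin.castSucc_succ]
    · rw [mergeAt_of_gt (by simpa using h'), mergeAt_of_gt h', mergeAt_of_gt (by simp; omega)]

/-- The merged pairs overlap in one entry, and associativity compares the two bracketings of the
resulting triple. -/
theorem mergeAt_mergeAt_self (hμ : ∀ x y z, μ (μ x y) z = μ x (μ y z)) {n : ℕ} (i : Fin n)
    (x : Fin (n + 2) → V) :
    mergeAt μ i (mergeAt μ i.succ x) = mergeAt μ i (mergeAt μ i.castSucc x) := by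
  funext m
  simp only [mergeAt, Fin.ext_iff, Fin.lt_def, Fin.val_castSucc, Fin.val_succ]
  split_ifs <;> first | rfl | omega | exact (hμ _ _ _).symm

theorem mergeAt_mergeAt (hμ : ∀ x y z, μ (μ x y) z = μ x (μ y z)) {n : ℕ} {i j : Fin n}
    (hij : i ≤ j) (x : Fin (n + 2) → V) :
    mergeAt μ i (mergeAt μ j.succ x) = mergeAt μ j (mergeAt μ i.castSucc x) := by
  rcases hij.lt_or_eq with h | rfl
  · exact mergeAt_mergeAt_of_lt h x
  · exact mergeAt_mergeAt_self hμ i x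

theorem mergeAt_succ_succ {n : ℕ} (i : Fin n) (x : Fin (n + 2) → V) :
    (fun j => mergeAt μ i.succ x j.succ) = mergeAt μ i fun j => x j.succ := by
  funext m
  simp only [mergeAt, Fin.ext_iff, Fin.lt_def, Fin.val_succ]
  split_ifs <;> first | rfl | omega

theorem mergeAt_castSucc_castSucc {n : ℕ} (i : Fin n) (x : Fin (n + 2) → V) :
    (fun j => mergeAt μ i.castSucc x j.castSucc) = mergeAt μ i fun j => x j.castSucc := by
  funext m
  simp only [mergeAt, Fin.ext_iff, Fin.lt_def, Fin.val_castSucc]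
  split_ifs <;> rfl

variable {l r}

/-- Each index is first, inner or last. The bimodule laws enter when both are first, both are last,
or one is first and the other last; associativity of `μ` enters when both are inner. Mixed inner and
outer cases are formal. -/
theorem hochFace_comp_hochFace (h : IsAssocBimodule μ l r) (n : ℕ) (i j : Fin (n + 2))
    (hij : i ≤ j) :
    hochFace μ l r (n + 1) j.succ ∘ₗ hochFace μ l r n i =
      hochFace μ l r (n + 1) i.castSucc ∘ₗ hochFace μ l r n j := by
  obtain ⟨hμ, hl, hlr, hr⟩ := h
  have key (p : Fin (n + 2)) : p = 0 ∨ (∃ m : Fin n, (p : ℕ) = m + 1) ∨ (p : ℕ) = n + 1 := by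
    have := p.2
    by_cases h₀ : (p : ℕ) = 0
    · exact .inl (Fin.ext h₀)
    by_cases h₁ : (p : ℕ) = n + 1
    · exact .inr (.inr h₁)
    · exact .inr (.inl ⟨⟨p - 1, by omega⟩, by simp only; omega⟩)
  ext f x
  rw [Fin.le_def] at hij
  rcases key i with rfl | ⟨i', hi⟩ | hi <;> rcases key j with rfl | ⟨j', hj⟩ | hj
  · rw [hochFace_of_val_eq_succ μ l r (i := Fin.succ 0) (0 : Fin (n + 1)) rfl]
    have : (fun m : Fin n => mergeAt μ (0 : Fin (n + 1)) x m.succ) = fun m => x m.succ.succ := by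
      funext m
      simp [mergeAt]
    simp only [LinearMap.comp_apply, Fin.castSucc_zero, hochFace_zero, mergeMap_apply,
      headMap_apply, this]
    simp [mergeAt_self, hl]
  · rw [hochFace_of_val_eq_succ μ l r j' hj, hochFace_of_val_eq_succ μ l r j'.succ (by simp [hj])]
    simp only [LinearMap.comp_apply, Fin.castSucc_zero, hochFace_zero, mergeMap_apply,
      headMap_apply, mergeAt_succ_succ]
    simp [mergeAt]
  · rw [hochFace_of_val_eq_last μ l r hj, hochFace_of_val_eq_last μ l r (by simp [hj])]
    simp only [LinearMap.comp_apply, Fin.castSucc_zero, hochFace_zero, lastMap_apply,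
      headMap_apply, hlr, Fin.castSucc_succ, Fin.succ_last]
  · simp [hi] at hij
  · rw [hochFace_of_val_eq_succ μ l r j' hj, hochFace_of_val_eq_succ μ l r j'.succ (by simp [hj]),
      hochFace_of_val_eq_succ μ l r i' hi,
      hochFace_of_val_eq_succ μ l r i'.castSucc (by simp [hi])]
    simp only [LinearMap.comp_apply, mergeMap_apply]
    rw [mergeAt_mergeAt hμ (by rw [Fin.le_def]; omega)]
  · rw [hochFace_of_val_eq_last μ l r hj, hochFace_of_val_eq_last μ l r (by simp [hj]),
      hochFace_of_val_eq_succ μ l r i' hi,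
      hochFace_of_val_eq_succ μ l r i'.castSucc (by simp [hi])]
    simp only [LinearMap.comp_apply, mergeMap_apply, lastMap_apply, mergeAt_castSucc_castSucc]
    have : mergeAt μ i'.castSucc x (Fin.last n) = x (Fin.last (n + 1)) := by
      have := i'.2
      simp only [mergeAt, Fin.lt_def, Fin.ext_iff, Fin.val_last, Fin.val_castSucc]
      split_ifs <;> first | rfl | omega
    rw [this]
  · simp [hi] at hij
  · omega
  · rw [hochFace_of_val_eq_last μ l r hj, hochFace_of_val_eq_last μ l r (by simp [hj]),
      hochFace_of_val_eq_last μ l r hi,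
      hochFace_of_val_eq_succ μ l r (Fin.last n) (by simp [hi])]
    have : (fun m : Fin n => mergeAt μ (Fin.last n) x m.castSucc) =
        fun m => x m.castSucc.castSucc := by
      funext m
      simp [mergeAt, Fin.castSucc_lt_last]
    simp only [LinearMap.comp_apply, mergeMap_apply, lastMap_apply, this, hr]
    simp [mergeAt]

theorem hochD_comp_hochD (h : IsAssocBimodule μ l r) (n : ℕ) :
    hochD μ l r (n + 1) ∘ₗ hochD μ l r n = 0 := by
  rw [hochD_eq_sum, hochD_eq_sum]
  exact alternatingSum_comp_eq_zero n _ _ (hochFace_comp_hochFace h n)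

end Hochschild

/-! ### Embedding a commutative tri-algebra into a commutative algebra -/

section Embedding

variable (k : Type v) [Field k] (A : Type u) [AddCommGroup A] [Module k A] [ComTriAlgebra k A]

namespace ComTriAlgebra

/-- The linear endomorphisms of a commutative tri-algebra that commute with all multiplications
`x • -` and `- ∗ z`. -/
def centroid : Submodule k (Module.End k A) where
  carrier := {T | (∀ x y, T (bul (k := k) x y) = bul (k := k) x (T y)) ∧
    ∀ x z, T (ast (k := k) x z) = ast (k := k) (T x) z}
  add_mem' := fun h h' => ⟨fun x y => by simp [h.1, h'.1], fun x y => by simp [h.2, h'.2]⟩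
  zero_mem' := ⟨fun x y => by simp, fun x y => by simp⟩
  smul_mem' := fun c T h => ⟨fun x y => by simp [h.1], fun x y => by simp [h.2]⟩

variable {A} in
theorem ast_right_comm (x y z : A) :
    ast (k := k) (ast (k := k) x y) z = ast (k := k) (ast (k := k) x z) y := by
  rw [ast_assoc, ast_perm, ast_assoc]

/-- Left multiplication by `x` for the product `•`, extended to `A × centroid` by letting a
central endomorphism `T` go to `T x`. -/
def bulMul : A →ₗ[k] Module.End k (A × centroid k A) :=
  LinearMap.mk₂ k (fun x p => (bul (k := k) x p.1 + p.2.1 x, 0))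
    (fun x x' p => by simp; abel)
    (fun c x p => by simp)
    (fun x p p' => by simp; abel)
    (fun c x p => by simp)

/-- Right multiplication by `z` for the product `∗`, acting on `A` and, by composition, on central
endomorphisms. -/
def astMul : A →ₗ[k] Module.End k (A × centroid k A) :=
  LinearMap.mk₂ k (fun z p => (ast (k := k) p.1 z, ⟨ast.flip z ∘ₗ p.2.1,
      fun x y => by simp [p.2.2.1, bul_ast],
      fun x y => by simp [p.2.2.2, ast_right_comm k _ y z]⟩))
    (fun z z' p => by ext <;> simp)
    (fun c z p => by ext <;> simp)
    (fun z p p' => by ext <;> simp)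
    (fun c z p => by ext <;> simp)

variable {A}

theorem bulMul_apply (x : A) (p : A × centroid k A) :
    bulMul k A x p = (bul (k := k) x p.1 + p.2.1 x, 0) := rfl

theorem astMul_apply_fst (z : A) (p : A × centroid k A) :
    (astMul k A z p).1 = ast (k := k) p.1 z := rfl

theorem astMul_apply_snd (z : A) (p : A × centroid k A) (x : A) :
    (astMul k A z p).2.1 x = ast (k := k) (p.2.1 x) z := rfl

/-- On a pair `(y, T)` this needs `T` to commute with `x • -`, the first condition in `centroid`;
the second condition plays the same role in `bulMul_ast`. -/
theorem bulMul_bul (x y : A) : bulMul k A (bul (k := k) x y) = bulMul k A x * bulMul k A y := by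
  refine LinearMap.ext fun p => ?_
  simp [bulMul_apply, bul_assoc, p.2.2.1]

theorem bulMul_ast (x z : A) : bulMul k A (ast (k := k) x z) = bulMul k A x * astMul k A z := by
  refine LinearMap.ext fun p => ?_
  rw [Module.End.mul_apply, bulMul_apply, bulMul_apply, astMul_apply_fst, astMul_apply_snd,
    p.2.2.2, bul_comm, ← bul_ast, bul_comm, bul_ast]

theorem astMul_mul (x z : A) : astMul k A x * astMul k A z = astMul k A (ast (k := k) x z) := by
  refine LinearMap.ext fun p => Prod.ext ?_ (Subtype.ext (LinearMap.ext fun y => ?_))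
  · simp [astMul_apply_fst, ast_right_comm k _ z x, ast_assoc]
  · simp only [Module.End.mul_apply, astMul_apply_snd, ast_right_comm k _ z x, ast_assoc]

theorem astMul_bul (x z : A) : astMul k A (bul (k := k) x z) = astMul k A (ast (k := k) x z) := by
  refine LinearMap.ext fun p => Prod.ext ?_ (Subtype.ext (LinearMap.ext fun y => ?_))
  · simp [astMul_apply_fst, ast_bul]
  · simp only [astMul_apply_snd, ast_bul]

theorem astMul_comm (x z : A) : astMul k A x * astMul k A z = astMul k A z * astMul k A x := by
  refine LinearMap.ext fun p => Prod.ext ?_ (Subtype.ext (LinearMap.ext fun y => ?_))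
  · simp [astMul_apply_fst, ast_right_comm k _ z x]
  · simp only [Module.End.mul_apply, astMul_apply_snd, ast_right_comm k _ z x]

theorem bulMul_astMul_comm (x z : A) :
    bulMul k A x * astMul k A z = astMul k A z * bulMul k A x := by
  refine LinearMap.ext fun p => Prod.ext ?_ (Subtype.ext (LinearMap.ext fun y => ?_))
  · simp only [Module.End.mul_apply, bulMul_apply, astMul_apply_fst, astMul_apply_snd, map_add,
      LinearMap.add_apply, bul_ast]
  · simp only [Module.End.mul_apply, bulMul_apply, astMul_apply_snd]
    simp

/-- Multiplication on `A` alone may fail to be faithful. The centroid contains the identity, which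
acts as an adjoined unit: `bulMul x` sends `(0, id)` to `(x, 0)`. -/
theorem bulMul_injective : Function.Injective (bulMul k A) := fun x y h => by
  have := congrArg Prod.fst (LinearMap.congr_fun h
    (0, ⟨LinearMap.id, fun _ _ => rfl, fun _ _ => rfl⟩))
  simpa [bulMul_apply] using this

variable (A) in
/-- Every commutative tri-algebra embeds into a commutative algebra `U`, such that `•` becomes the
product of `U` and `∗` becomes the product with a multiplicative map `e`. -/
theorem exists_embedding : ∃ (U : Type u) (_ : CommRing U) (_ : Algebra k U) (j e : A →ₗ[k] U),
    Function.Injective j ∧ (∀ x y, j (bul (k := k) x y) = j x * j y) ∧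
    (∀ x y, j (ast (k := k) x y) = j x * e y) ∧
    (∀ x y, e (bul (k := k) x y) = e x * e y) ∧
    (∀ x y, e (ast (k := k) x y) = e x * e y) := by
  -- `U` is the algebra generated by all these operators. It is commutative because the generators
  -- commute pairwise.
  let s : Set (Module.End k (A × centroid k A)) := Set.range (bulMul k A) ∪ Set.range (astMul k A)
  have hs : ∀ a ∈ s, ∀ b ∈ s, a * b = b * a := by
    rintro _ (⟨x, rfl⟩ | ⟨x, rfl⟩) _ (⟨y, rfl⟩ | ⟨y, rfl⟩)
    · rw [← bulMul_bul, bul_comm, bulMul_bul]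
    · exact bulMul_astMul_comm k x y
    · exact (bulMul_astMul_comm k y x).symm
    · exact astMul_comm k x y
  have hc := Algebra.isMulCommutative_adjoin k hs
  let : CommRing (Algebra.adjoin k s) :=
    { Subalgebra.toRing (Algebra.adjoin k s) with mul_comm := hc.is_comm.comm }
  refine ⟨Algebra.adjoin k s, this, (Algebra.adjoin k s).algebra,
    (bulMul k A).codRestrict (Subalgebra.toSubmodule (Algebra.adjoin k s))
      fun x => Algebra.subset_adjoin (.inl ⟨x, rfl⟩),
    (astMul k A).codRestrict (Subalgebra.toSubmodule (Algebra.adjoin k s))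
      fun x => Algebra.subset_adjoin (.inr ⟨x, rfl⟩),
    fun x y h => bulMul_injective k (congrArg Subtype.val h),
    fun x y => Subtype.ext (bulMul_bul k x y), fun x y => Subtype.ext (bulMul_ast k x y),
    fun x y => Subtype.ext ?_, fun x y => Subtype.ext (astMul_mul k x y).symm⟩
  exact (astMul_bul k x y).trans (astMul_mul k x y).symm

end ComTriAlgebra

end Embedding

/-! ### The elements `P(a₁, …, aₙ; I)` -/

section PElem

variable {k : Type v} [Field k] {A : Type u} [AddCommGroup A] [Module k A]

theorem map_listProd {U : Type*} [Monoid U] (μ : A →ₗ[k] A →ₗ[k] A) (φ : A → U)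
    (hφ : ∀ x y, φ (μ x y) = φ x * φ y) {L : List A} (hL : L ≠ []) :
    φ (listProd k μ L) = (L.map φ).prod := by
  cases L with
  | nil => exact absurd rfl hL
  | cons x L =>
    simp only [listProd, List.map_cons, List.prod_cons]
    induction L generalizing x with
    | nil => simp
    | cons y L ih => simp [ih, hφ, mul_assoc]

variable [ComTriAlgebra k A]

/-- In a commutative monoid where `•` is multiplication and `∗` is multiplication twisted by `e`,
`P(a; I)` is a product over all indices. -/
theorem map_pElem {U : Type*} [CommMonoid U] (j e : A → U)
    (hjb : ∀ x y, j (ComTriAlgebra.bul (k := k) x y) = j x * j y)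
    (hja : ∀ x y, j (ComTriAlgebra.ast (k := k) x y) = j x * e y)
    (hea : ∀ x y, e (ComTriAlgebra.ast (k := k) x y) = e x * e y)
    {n : ℕ} (a : Fin n → A) (I : NonemptySubset n) :
    j (pElem k a I) = ∏ i, if i ∈ I.1 then j (a i) else e (a i) := by
  have hprod (p : Fin n → Prop) [DecidablePred p] (φ : A → U) :
      ((((List.finRange n).filter p).map a).map φ).prod = ∏ i with p i, φ (a i) := by
    rw [List.map_map]
    have := List.prod_toFinset (fun i => φ (a i))
      ((List.nodup_finRange n).filter (fun i => decide (p i)))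
    rw [show (φ ∘ a) = fun i => φ (a i) from rfl, ← this]
    congr 1
    ext i
    simp
  rw [Finset.prod_ite]
  obtain ⟨i₀, hi₀⟩ := I.2
  have h₁ : ((List.finRange n).filter (· ∈ I.1)).map a ≠ [] := by
    simp only [ne_eq, List.map_eq_nil_iff, List.filter_eq_nil_iff, not_forall]
    exact ⟨i₀, List.mem_finRange _, by simpa using hi₀⟩
  unfold pElem
  split_ifs with h
  · rw [map_listProd _ j hjb h₁, hprod]
    simp [h]
  · have h₂ : ((List.finRange n).filter (· ∉ I.1)).map a ≠ [] := by
      obtain ⟨i, hi⟩ := not_forall.1 (mt Finset.eq_univ_iff_forall.2 h)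
      simp only [ne_eq, List.map_eq_nil_iff, List.filter_eq_nil_iff, not_forall]
      exact ⟨i, List.mem_finRange _, by simpa using hi⟩
    rw [hja, map_listProd _ j hjb h₁, hprod, map_listProd _ e hea h₂, hprod]

/-- `P(-; I)` as a multilinear map. -/
noncomputable def pMulti {n : ℕ} (I : NonemptySubset n) : MultilinearMap k (fun _ : Fin n => A) A :=
  -- After the injective map `j`, `P(-; I)` becomes a product of linear maps in separate variables,
  -- which is visibly multilinear; linearity in each variable then descends to `A`.
  have key : ∃ (U : Type u) (_ : CommRing U) (_ : Algebra k U) (j : A →ₗ[k] U)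
      (F : MultilinearMap k (fun _ : Fin n => A) U),
      Function.Injective j ∧ ∀ a, j (pElem k a I) = F a := by
    obtain ⟨U, _, _, j, e, hj, hjb, hja, -, hea⟩ := ComTriAlgebra.exists_embedding k A
    refine ⟨U, _, _, j, (MultilinearMap.mkPiAlgebra k (Fin n) U).compLinearMap
      (fun i => if i ∈ I.1 then j else e), hj, fun a => ?_⟩
    rw [map_pElem j e hjb hja hea, MultilinearMap.compLinearMap_apply,
      MultilinearMap.mkPiAlgebra_apply]
    refine Finset.prod_congr rfl fun i _ => ?_
    split_ifs <;> rfl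
  MultilinearMap.mk' (fun a => pElem k a I)
    (fun m i x y => by
      obtain ⟨U, _, _, j, F, hj, hF⟩ := key
      apply hj
      simp only [map_add, hF, MultilinearMap.map_update_add])
    (fun m i c x => by
      obtain ⟨U, _, _, j, F, hj, hF⟩ := key
      apply hj
      simp only [map_smul, hF, MultilinearMap.map_update_smul])

@[simp]
theorem pMulti_apply {n : ℕ} (I : NonemptySubset n) (a : Fin n → A) :
    pMulti (k := k) I a = pElem k a I := rfl

end PElem

/-! ### Multilinear maps on tensor products -/

section MultilinearTensor

variable {k : Type v} [Field k] {A B T S : Type u} [AddCommGroup A] [Module k A]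
  [AddCommGroup B] [Module k B] [AddCommGroup T] [Module k T] [AddCommGroup S] [Module k S]

/-- The linear map on the tensor algebra that extends an `n`-linear map. -/
noncomputable def TensorAlgebra.liftPower {n : ℕ} (f : MultilinearMap k (fun _ : Fin n => A) T) :
    TensorAlgebra k A →ₗ[k] T :=
  PiTensorProduct.lift f ∘ₗ DirectSum.component k ℕ (fun n => ⨂[k]^n A) n ∘ₗ
    TensorAlgebra.toDirectSum.toLinearMap

theorem TensorAlgebra.liftPower_tprod {n : ℕ} (f : MultilinearMap k (fun _ : Fin n => A) T)
    (a : Fin n → A) : liftPower f (TensorAlgebra.tprod k A n a) = f a := by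
  simp only [liftPower, LinearMap.comp_apply, AlgHom.toLinearMap_apply,
    toDirectSum_tensorPower_tprod, DirectSum.component]
  erw [DirectSum.of_eq_same]
  exact PiTensorProduct.lift.tprod _

/-- From `f` multilinear on `A` and `g` multilinear on `B`, the multilinear map on `A ⊗ B` with
`(a₁ ⊗ b₁, …, aₙ ⊗ bₙ) ↦ f (a₁, …, aₙ) ⊗ g (b₁, …, bₙ)`. -/
noncomputable def multiTensor {n : ℕ} (f : MultilinearMap k (fun _ : Fin n => A) T)
    (g : MultilinearMap k (fun _ : Fin n => B) S) :
    MultilinearMap k (fun _ : Fin n => A ⊗[k] B) (T ⊗[k] S) :=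
  -- In the algebra `T(A) ⊗ T(B)` the product of the `aᵢ ⊗ bᵢ` is `(a₁ ⋯ aₙ) ⊗ (b₁ ⋯ bₙ)`, which
  -- separates the two families of variables.
  (TensorProduct.map (TensorAlgebra.liftPower f)
    (TensorAlgebra.liftPower g)).compMultilinearMap
      ((MultilinearMap.mkPiAlgebraFin k n (TensorAlgebra k A ⊗[k] TensorAlgebra k B)).compLinearMap
        fun _ => TensorProduct.map (TensorAlgebra.ι k) (TensorAlgebra.ι k))

theorem multiTensor_tmul {n : ℕ} (f : MultilinearMap k (fun _ : Fin n => A) T)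
    (g : MultilinearMap k (fun _ : Fin n => B) S) (a : Fin n → A) (b : Fin n → B) :
    multiTensor f g (fun i => a i ⊗ₜ b i) = f a ⊗ₜ g b := by
  have key : ∀ L : List (Fin n), (L.map fun i =>
      (TensorAlgebra.ι k (a i) ⊗ₜ[k] TensorAlgebra.ι k (b i))).prod =
      (L.map fun i => TensorAlgebra.ι k (a i)).prod ⊗ₜ
        (L.map fun i => TensorAlgebra.ι k (b i)).prod := by
    intro L
    induction L with
    | nil => rfl
    | cons i L ih => simp [ih]
  rw [← TensorAlgebra.liftPower_tprod f a, ← TensorAlgebra.liftPower_tprod g b]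
  simp only [multiTensor, LinearMap.compMultilinearMap_apply, MultilinearMap.compLinearMap_apply,
    MultilinearMap.mkPiAlgebraFin_apply, TensorProduct.map_tmul, List.ofFn_eq_map, key,
    TensorAlgebra.tprod_apply]

/-- Over a field, `A ⊗ B` has a basis of pure tensors, and a multilinear map is determined on basis
vectors. -/
theorem MultilinearMap.ext_tmul {n : ℕ} {F G : MultilinearMap k (fun _ : Fin n => A ⊗[k] B) T}
    (h : ∀ (a : Fin n → A) (b : Fin n → B),
      F (fun i => a i ⊗ₜ b i) = G (fun i => a i ⊗ₜ b i)) : F = G := by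
  let c := (Module.Basis.ofVectorSpace k A).tensorProduct (Module.Basis.ofVectorSpace k B)
  refine Module.Basis.ext_multilinear (fun _ => c) fun v => ?_
  simp only [c, Module.Basis.tensorProduct_apply']
  exact h _ _

end MultilinearTensor

/-! ### Nonempty subsets of `Fin (n + 1)` -/

section Subsets

/-- The image of a nonempty subset of `Fin n` under `p.succAbove`. -/
def NonemptySubset.lift {n : ℕ} (p : Fin (n + 1)) (J : NonemptySubset n) :
    NonemptySubset (n + 1) :=
  ⟨J.1.map p.succAboveEmb, J.2.map⟩

/-- The image of a subset of `Fin n` under `p.succAbove`, together with `p`. -/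
def NonemptySubset.adjoin {n : ℕ} (p : Fin (n + 1)) (L : Finset (Fin n)) :
    NonemptySubset (n + 1) :=
  ⟨insert p (L.map p.succAboveEmb), Finset.insert_nonempty _ _⟩

namespace NonemptySubset

variable {n : ℕ} (p : Fin (n + 1))

@[simp]
theorem succAbove_mem_lift {J : NonemptySubset n} {x : Fin n} :
    p.succAbove x ∈ (lift p J).1 ↔ x ∈ J.1 :=
  Finset.mem_map' p.succAboveEmb

@[simp]
theorem notMem_lift {J : NonemptySubset n} : p ∉ (lift p J).1 := by
  simp [lift, Fin.succAbove_ne]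

@[simp]
theorem succAbove_mem_adjoin {L : Finset (Fin n)} {x : Fin n} :
    p.succAbove x ∈ (adjoin p L).1 ↔ x ∈ L := by
  rw [adjoin, Finset.mem_insert, or_iff_right (Fin.succAbove_ne p x)]
  exact Finset.mem_map' p.succAboveEmb

@[simp]
theorem mem_adjoin {L : Finset (Fin n)} : p ∈ (adjoin p L).1 := Finset.mem_insert_self _ _

variable {p}

theorem ext_succAbove {I I' : NonemptySubset (n + 1)} (h : p ∈ I.1 ↔ p ∈ I'.1)
    (h' : ∀ x, p.succAbove x ∈ I.1 ↔ p.succAbove x ∈ I'.1) : I = I' := by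
  refine Subtype.ext (Finset.ext fun x => ?_)
  cases x using p.succAboveCases with
  | x => exact h
  | p x => exact h' x

theorem lift_injective : Function.Injective (lift p) := fun J J' h =>
  Subtype.ext (Finset.ext fun x => by
    rw [← succAbove_mem_lift p, h, succAbove_mem_lift])

theorem adjoin_injective : Function.Injective (adjoin p) := fun J J' h =>
  Finset.ext fun x => by
    rw [← succAbove_mem_adjoin p, h, succAbove_mem_adjoin]

theorem lift_ne_adjoin (J : NonemptySubset n) (L : Finset (Fin n)) : lift p J ≠ adjoin p L :=
  fun h => notMem_lift p (J := J) (h ▸ mem_adjoin p)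

variable (p) in
theorem eq_lift_or_eq_adjoin (I : NonemptySubset (n + 1)) :
    (∃ J, I = lift p J) ∨ ∃ L, I = adjoin p L := by
  by_cases h : p ∈ I.1
  · exact .inr ⟨Finset.univ.filter fun x => p.succAbove x ∈ I.1,
      ext_succAbove (p := p) (by simp [h]) (by simp)⟩
  · obtain ⟨y, hy⟩ := I.2
    obtain ⟨x, rfl⟩ := Fin.exists_succAbove_eq (fun e : y = p => h (e ▸ hy))
    exact .inl ⟨⟨Finset.univ.filter fun x => p.succAbove x ∈ I.1, x, by simpa using hy⟩,
      ext_succAbove (p := p) (by simp [h]) (by simp)⟩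

variable (p) in
-- The three classes of index sets, `{p}`, those avoiding `p`, and those containing `p` properly,
-- match the three terms of `tensorOp` in the outer terms of the differential.
theorem sum_eq {M : Type*} [AddCommMonoid M] (F : NonemptySubset (n + 1) → M) :
    ∑ I, F I = F (adjoin p ∅) + ∑ J : NonemptySubset n, (F (lift p J) + F (adjoin p J.1)) := by
  rw [← Fintype.sum_bijective (Sum.elim (fun _ : Unit => adjoin p ∅)
    (Sum.elim (lift p) fun J : NonemptySubset n => adjoin p J.1)) ⟨?_, ?_⟩ _ F (fun _ => rfl)]
  · simp [Finset.sum_add_distrib]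
  · rintro (x | x | x) (y | y | y) h <;> simp only [Sum.elim_inl, Sum.elim_inr] at h
    · rfl
    · exact (lift_ne_adjoin _ _ h.symm).elim
    · exact (y.2.ne_empty (adjoin_injective h).symm).elim
    · exact (lift_ne_adjoin _ _ h).elim
    · rw [lift_injective h]
    · exact (lift_ne_adjoin _ _ h).elim
    · exact (x.2.ne_empty (adjoin_injective h)).elim
    · exact (lift_ne_adjoin _ _ h.symm).elim
    · rw [Subtype.ext (adjoin_injective h)]
  · intro I
    rcases eq_lift_or_eq_adjoin p I with ⟨J, rfl⟩ | ⟨L, rfl⟩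
    · exact ⟨.inr (.inl J), rfl⟩
    · rcases L.eq_empty_or_nonempty with rfl | hL
      · exact ⟨.inl (), rfl⟩
      · exact ⟨.inr (.inr ⟨L, hL⟩), rfl⟩

theorem collapse_lift (i : Fin n) (J : NonemptySubset n) : collapse (lift i.castSucc J) i = J := by
  refine Subtype.ext ?_
  ext x
  simp [collapse, lift]

theorem collapse_adjoin (i : Fin n) (L : Finset (Fin n)) :
    (collapse (adjoin i.castSucc L) i).1 = insert i L := by
  ext x
  simp [collapse, adjoin]

end NonemptySubset

end Subsets

/-! ### Identities between the elements `P(a; I)` -/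

section PElemIdentities

open NonemptySubset

variable {k : Type v} [Field k] {A : Type u} [AddCommGroup A] [Module k A] [ComTriAlgebra k A]
  {n : ℕ}

theorem pElem_lift (p : Fin (n + 1)) (a : Fin (n + 1) → A) (J : NonemptySubset n) :
    pElem k a (lift p J) =
      ComTriAlgebra.ast (k := k) (pElem k (fun x => a (p.succAbove x)) J) (a p) := by
  obtain ⟨U, _, _, j, e, hj, hjb, hja, heb, hea⟩ := ComTriAlgebra.exists_embedding k A
  apply hj
  rw [hja, map_pElem j e hjb hja hea, map_pElem j e hjb hja hea, Fin.prod_univ_succAbove _ p]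
  simp [mul_comm]

theorem pElem_adjoin (p : Fin (n + 1)) (a : Fin (n + 1) → A) (J : NonemptySubset n) :
    pElem k a (adjoin p J.1) =
      ComTriAlgebra.bul (k := k) (a p) (pElem k (fun x => a (p.succAbove x)) J) := by
  obtain ⟨U, _, _, j, e, hj, hjb, hja, heb, hea⟩ := ComTriAlgebra.exists_embedding k A
  apply hj
  rw [hjb, map_pElem j e hjb hja hea, map_pElem j e hjb hja hea, Fin.prod_univ_succAbove _ p]
  simp

/-- The right factor of `∗` is seen only through `e`, and `e` sends `P(-; J)` to the same product
for every `J`. This independence of `J` is the origin of the sums over `J` in the differential. -/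
theorem pElem_adjoin_empty (p : Fin (n + 1)) (a : Fin (n + 1) → A) (J : NonemptySubset n) :
    pElem k a (adjoin p ∅) =
      ComTriAlgebra.ast (k := k) (a p) (pElem k (fun x => a (p.succAbove x)) J) := by
  obtain ⟨U, _, _, j, e, hj, hjb, hja, heb, hea⟩ := ComTriAlgebra.exists_embedding k A
  apply hj
  -- The second use of `map_pElem` puts `e` in both roles, so that `J` disappears.
  rw [hja, map_pElem j e hjb hja hea, map_pElem e e heb hea hea, Fin.prod_univ_succAbove _ p]
  simp

/-- Skipping entry `i` puts `xᵢ₊₁` in slot `i`, where it is overwritten. In this form multilinearity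
applies to the merged slot. -/
theorem mergeAt_eq_update {V : Type u} [AddCommGroup V] [Module k V] (μ : V →ₗ[k] V →ₗ[k] V)
    (i : Fin n) (x : Fin (n + 1) → V) :
    mergeAt μ i x = Function.update (fun j => x (i.castSucc.succAbove j)) i
      (μ (x i.castSucc) (x i.succ)) := by
  funext j
  rcases lt_trichotomy j i with h | rfl | h
  · rw [Function.update_of_ne h.ne, mergeAt_of_lt h,
      Fin.succAbove_of_castSucc_lt _ _ (Fin.castSucc_lt_castSucc_iff.2 h)]
  · rw [mergeAt_self, Function.update_self]
  · rw [Function.update_of_ne h.ne', mergeAt_of_gt h,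
      Fin.succAbove_of_le_castSucc _ _ (Fin.castSucc_le_castSucc_iff.2 h.le)]

theorem mergeAt_of_ne {V : Type u} [AddCommGroup V] [Module k V] (μ : V →ₗ[k] V →ₗ[k] V)
    {i j : Fin n} (h : j ≠ i) (x : Fin (n + 1) → V) :
    mergeAt μ i x j = x (i.castSucc.succAbove j) := by
  rw [mergeAt_eq_update, Function.update_of_ne h]

theorem Finset.prod_eq_mul_prod_of_eq_off {U ι : Type*} [CommMonoid U] [Fintype ι] [DecidableEq ι]
    {F G : ι → U} {c : U} (i : ι) (hi : F i = c * G i) (h : ∀ j, j ≠ i → F j = G j) :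
    ∏ j, F j = c * ∏ j, G j := by
  rw [← Finset.mul_prod_erase _ F (Finset.mem_univ i),
    ← Finset.mul_prod_erase _ G (Finset.mem_univ i), hi, mul_assoc]
  congr 2
  exact Finset.prod_congr rfl fun j hj => h j (Finset.ne_of_mem_erase hj)

/-- For `i ∈ J`, the products `x ∗ y`, `y ∗ x` and `x • y` in slot `i` leave unstarred only the left
factor, only the right one, or both. This lemma and the next two thus realize the three index sets
that collapse to `J`. -/
theorem pElem_mergeAt_ast (i : Fin n) (a : Fin (n + 1) → A) {J : NonemptySubset n}
    (hi : i ∈ J.1) :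
    pElem k (mergeAt (ComTriAlgebra.ast (k := k)) i a) J =
      pElem k a (adjoin i.castSucc (J.1.erase i)) := by
  obtain ⟨U, _, _, j, e, hj, hjb, hja, heb, hea⟩ := ComTriAlgebra.exists_embedding k A
  apply hj
  rw [map_pElem j e hjb hja hea, map_pElem j e hjb hja hea,
    Fin.prod_univ_succAbove _ i.castSucc]
  refine Finset.prod_eq_mul_prod_of_eq_off i ?_ fun x hx => ?_
  · simp only [mergeAt_self, succAbove_mem_adjoin]
    simp [hi, hja]
  · simp only [mergeAt_of_ne _ hx, succAbove_mem_adjoin]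
    simp [hx]

theorem pElem_mergeAt_flip_ast (i : Fin n) (a : Fin (n + 1) → A) {J : NonemptySubset n}
    (hi : i ∈ J.1) :
    pElem k (mergeAt (ComTriAlgebra.ast (k := k)).flip i a) J =
      pElem k a (lift i.castSucc J) := by
  obtain ⟨U, _, _, j, e, hj, hjb, hja, heb, hea⟩ := ComTriAlgebra.exists_embedding k A
  apply hj
  rw [map_pElem j e hjb hja hea, map_pElem j e hjb hja hea,
    Fin.prod_univ_succAbove _ i.castSucc]
  refine Finset.prod_eq_mul_prod_of_eq_off i ?_ fun x hx => ?_
  · simp only [mergeAt_self, succAbove_mem_lift]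
    simp [hi, hja, mul_comm]
  · simp only [mergeAt_of_ne _ hx, succAbove_mem_lift]

theorem pElem_mergeAt_bul (i : Fin n) (a : Fin (n + 1) → A) {J : NonemptySubset n}
    (hi : i ∈ J.1) :
    pElem k (mergeAt (ComTriAlgebra.bul (k := k)) i a) J =
      pElem k a (adjoin i.castSucc J.1) := by
  obtain ⟨U, _, _, j, e, hj, hjb, hja, heb, hea⟩ := ComTriAlgebra.exists_embedding k A
  apply hj
  rw [map_pElem j e hjb hja hea, map_pElem j e hjb hja hea,
    Fin.prod_univ_succAbove _ i.castSucc]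
  refine Finset.prod_eq_mul_prod_of_eq_off i ?_ fun x hx => ?_
  · simp only [mergeAt_self, succAbove_mem_adjoin]
    simp [hi, hjb]
  · simp only [mergeAt_of_ne _ hx, succAbove_mem_adjoin]

/-- Any of the three products may be used to merge two factors outside of `J`. -/
theorem pElem_mergeAt_of_notMem (i : Fin n) (a : Fin (n + 1) → A) {J : NonemptySubset n}
    (hi : i ∉ J.1) (μ : A →ₗ[k] A →ₗ[k] A)
    (hμ : μ = ComTriAlgebra.ast ∨ μ = ComTriAlgebra.ast.flip ∨ μ = ComTriAlgebra.bul) :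
    pElem k (mergeAt μ i a) J = pElem k a (lift i.castSucc J) := by
  obtain ⟨U, _, _, j, e, hj, hjb, hja, heb, hea⟩ := ComTriAlgebra.exists_embedding k A
  have he : ∀ x y, e (μ x y) = e x * e y := by
    rcases hμ with rfl | rfl | rfl <;> simp [hea, heb, mul_comm]
  apply hj
  rw [map_pElem j e hjb hja hea, map_pElem j e hjb hja hea,
    Fin.prod_univ_succAbove _ i.castSucc]
  refine Finset.prod_eq_mul_prod_of_eq_off i ?_ fun x hx => ?_
  · simp only [mergeAt_self, succAbove_mem_lift]
    simp [hi, he]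
  · simp only [mergeAt_of_ne _ hx, succAbove_mem_lift]

end PElemIdentities

/-! ### The embedding of cochains -/

section Psi

open NonemptySubset

variable (k : Type v) [Field k] (A B N : Type u) [AddCommGroup A] [Module k A] [ComTriAlgebra k A]
  [AddCommGroup B] [Module k B] [AddCommGroup N] [Module k N]

variable {B N} in
theorem sum_multiTensor_tmul {n : ℕ} (g : TriCochain k B N n) (a : Fin n → A) (b : Fin n → B) :
    (∑ I, multiTensor (pMulti (k := k) (A := A) I) (g I)) (fun i => a i ⊗ₜ[k] b i) =
      ∑ I, pElem k a I ⊗ₜ[k] g I b := by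
  simp [multiTensor_tmul]

/-- The map `g ↦ ∑ P(-; I) ⊗ g(I; -)` from tri-dendriform to Hochschild cochains. -/
noncomputable def psi (n : ℕ) : TriCochain k B N n →ₗ[k]
    MultilinearMap k (fun _ : Fin n => A ⊗[k] B) (A ⊗[k] N) where
  toFun g := ∑ I, multiTensor (pMulti I) (g I)
  map_add' g g' := MultilinearMap.ext_tmul fun a b => by
    simp only [add_apply, sum_multiTensor_tmul, Pi.add_apply,
      TensorProduct.tmul_add, Finset.sum_add_distrib]
  map_smul' c g := MultilinearMap.ext_tmul fun a b => by
    rw [RingHom.id_apply, smul_apply, sum_multiTensor_tmul, sum_multiTensor_tmul,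
      Finset.smul_sum]
    simp only [Pi.smul_apply, smul_apply, TensorProduct.tmul_smul]

variable {B N}

theorem psi_tmul {n : ℕ} (g : TriCochain k B N n) (a : Fin n → A) (b : Fin n → B) :
    psi k A B N n g (fun i => a i ⊗ₜ[k] b i) = ∑ I, pElem k a I ⊗ₜ[k] g I b :=
  sum_multiTensor_tmul k A g a b

variable {A}

theorem mergeAt_add {n : ℕ} (f : MultilinearMap k (fun _ : Fin n => B) N)
    (μ ν : B →ₗ[k] B →ₗ[k] B) (i : Fin n) (b : Fin (n + 1) → B) :
    f (mergeAt (μ + ν) i b) = f (mergeAt μ i b) + f (mergeAt ν i b) := by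
  simp only [mergeAt_eq_update, LinearMap.add_apply, MultilinearMap.map_update_add]

/-! ### Inner terms of the differential. -/

variable [TriDendriform k B]

/-- Passing to `σᵢ(I)` forgets only which of `i` and `i + 1` lie in `I`, once at least one of them
does. -/
theorem filter_collapse_eq_of_mem {n : ℕ} {i : Fin n} {J : NonemptySubset n} (hi : i ∈ J.1) :
    (Finset.univ.filter fun I => collapse I i = J) =
      {adjoin i.castSucc (J.1.erase i), lift i.castSucc J, adjoin i.castSucc J.1} := by
  ext I
  simp only [Finset.mem_filter_univ, Finset.mem_insert, Finset.mem_singleton]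
  constructor
  · rintro rfl
    rcases eq_lift_or_eq_adjoin i.castSucc I with ⟨J, rfl⟩ | ⟨L, rfl⟩
    · rw [collapse_lift]
      exact .inr (.inl rfl)
    · rw [collapse_adjoin]
      by_cases h : i ∈ L
      · rw [Finset.insert_eq_of_mem h]
        exact .inr (.inr rfl)
      · rw [Finset.erase_insert h]
        exact .inl rfl
  · rintro (rfl | rfl | rfl)
    · exact Subtype.ext (by rw [collapse_adjoin, Finset.insert_erase hi])
    · exact collapse_lift i J
    · exact Subtype.ext (by rw [collapse_adjoin, Finset.insert_eq_of_mem hi])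

theorem filter_collapse_eq_of_notMem {n : ℕ} {i : Fin n} {J : NonemptySubset n} (hi : i ∉ J.1) :
    (Finset.univ.filter fun I => collapse I i = J) = {lift i.castSucc J} := by
  ext I
  simp only [Finset.mem_filter_univ, Finset.mem_singleton]
  constructor
  · rintro rfl
    rcases eq_lift_or_eq_adjoin i.castSucc I with ⟨J, rfl⟩ | ⟨L, rfl⟩
    · rw [collapse_lift]
    · rw [collapse_adjoin] at hi
      simp at hi
  · rintro rfl
    exact collapse_lift i J

theorem mergeAt_tensorMul {n : ℕ} {T : Type u} [AddCommGroup T] [Module k T]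
    (F : MultilinearMap k (fun _ : Fin n => A ⊗[k] B) T) (i : Fin n) (a : Fin (n + 1) → A)
    (b : Fin (n + 1) → B) :
    F (mergeAt (tensorMul k A B) i fun j => a j ⊗ₜ[k] b j) =
      F (fun j => mergeAt (ComTriAlgebra.ast (k := k)) i a j ⊗ₜ[k]
        mergeAt (TriDendriform.prec (k := k)) i b j) +
      F (fun j => mergeAt (ComTriAlgebra.ast (k := k)).flip i a j ⊗ₜ[k]
        mergeAt (TriDendriform.succ (k := k)) i b j) +
      F (fun j => mergeAt (ComTriAlgebra.bul (k := k)) i a j ⊗ₜ[k]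
        mergeAt (TriDendriform.dot (k := k)) i b j) := by
  have key (μ : A →ₗ[k] A →ₗ[k] A) (ν : B →ₗ[k] B →ₗ[k] B) :
      (fun j => mergeAt μ i a j ⊗ₜ[k] mergeAt ν i b j) =
        Function.update (fun j => a (i.castSucc.succAbove j) ⊗ₜ[k] b (i.castSucc.succAbove j)) i
          (μ (a i.castSucc) (a i.succ) ⊗ₜ[k] ν (b i.castSucc) (b i.succ)) := by
    funext j
    rw [mergeAt_eq_update, mergeAt_eq_update]
    by_cases h : j = i
    · subst h
      simp
    · simp [h]
  rw [key, key, key, mergeAt_eq_update, tensorMul, tensorOp_tmul, MultilinearMap.map_update_add,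
    MultilinearMap.map_update_add]
  rfl

theorem mergeMap_psi_tmul {n : ℕ} (g : TriCochain k B N n) (i : Fin n) (a : Fin (n + 1) → A)
    (b : Fin (n + 1) → B) :
    mergeMap (tensorMul k A B) i (psi k A B N n g) (fun j => a j ⊗ₜ[k] b j) =
      ∑ I, pElem k a I ⊗ₜ[k] mergeMap (innerOp k I.1 i) i (g (collapse I i)) b := by
  -- Both sides become sums over `J`, the right one by grouping the `I` with `collapse I i = J`.
  -- Each fibre has three elements if `i ∈ J`, one for each product, and a single element otherwise;
  -- in that case the three products share the same `P` and their coefficients add up to `∘`.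
  rw [mergeMap_apply, mergeAt_tensorMul, psi_tmul, psi_tmul, psi_tmul,
    ← Finset.sum_add_distrib, ← Finset.sum_add_distrib,
    ← Finset.sum_fiberwise _ (fun I => collapse I i)]
  refine Finset.sum_congr rfl fun J _ => ?_
  have hop (L : Finset (Fin n)) : innerOp k (B := B) (adjoin i.castSucc L).1 i =
      if i ∈ L then TriDendriform.dot else TriDendriform.prec := by
    have := succAbove_mem_adjoin i.castSucc (L := L) (x := i)
    rw [Fin.succAbove_castSucc_self] at this
    simp only [innerOp, mem_adjoin, this, if_true]
  have hop' : innerOp k (B := B) (lift i.castSucc J).1 i =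
      if i ∈ J.1 then TriDendriform.succ
      else TriDendriform.prec + TriDendriform.succ + TriDendriform.dot := by
    have := succAbove_mem_lift i.castSucc (J := J) (x := i)
    rw [Fin.succAbove_castSucc_self] at this
    simp only [innerOp, notMem_lift, this, if_false]
  have hsum : ∀ s : Finset (NonemptySubset (n + 1)), (∀ I ∈ s, collapse I i = J) →
      ∑ I ∈ s, pElem k a I ⊗ₜ[k] mergeMap (innerOp k I.1 i) i (g (collapse I i)) b =
        ∑ I ∈ s, pElem k a I ⊗ₜ[k] g J (mergeAt (innerOp k I.1 i) i b) := fun s hs =>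
    Finset.sum_congr rfl fun I hI => by rw [hs I hI, mergeMap_apply]
  rw [hsum _ fun I hI => (Finset.mem_filter.1 hI).2]
  by_cases hi : i ∈ J.1
  · have h₁ : adjoin i.castSucc (J.1.erase i) ≠ adjoin i.castSucc J.1 := fun h =>
      Finset.notMem_erase i J.1 ((adjoin_injective h).symm ▸ hi)
    rw [filter_collapse_eq_of_mem hi, Finset.sum_insert, Finset.sum_insert, Finset.sum_singleton,
      hop, hop, hop', pElem_mergeAt_ast i a hi, pElem_mergeAt_flip_ast i a hi,
      pElem_mergeAt_bul i a hi, if_pos hi, if_pos hi, if_neg (Finset.notMem_erase i _), add_assoc]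
    · simpa using lift_ne_adjoin _ _
    · simp [h₁, (lift_ne_adjoin J (J.1.erase i)).symm]
  · rw [filter_collapse_eq_of_notMem hi, Finset.sum_singleton, hop', if_neg hi,
      pElem_mergeAt_of_notMem i a hi _ (.inl rfl), pElem_mergeAt_of_notMem i a hi _ (.inr (.inl rfl)),
      pElem_mergeAt_of_notMem i a hi _ (.inr (.inr rfl)), mergeAt_add, mergeAt_add,
      TensorProduct.tmul_add, TensorProduct.tmul_add]

/-! ### Outer terms and compatibility with the differentials. -/

variable [TriDendModule k B N]

theorem triHead_adjoin_empty {n : ℕ} (g : TriCochain k B N n) :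
    triHead k B N g (adjoin 0 ∅) = ∑ J, headMap TriDendModule.lprec n (g J) := by
  have : ¬ (Finset.univ.filter fun j : Fin n => j.succ ∈ (adjoin 0 ∅).1).Nonempty := by
    simp only [← Fin.succAbove_zero, succAbove_mem_adjoin]
    simp
  rw [triHead, dif_neg this]

theorem triHead_lift {n : ℕ} (g : TriCochain k B N n) (J : NonemptySubset n) :
    triHead k B N g (lift 0 J) = headMap TriDendModule.lsucc n (g J) := by
  have : (Finset.univ.filter fun j : Fin n => j.succ ∈ (lift 0 J).1) = J.1 := by
    simp only [← Fin.succAbove_zero, succAbove_mem_lift]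
    simp
  rw [triHead, dif_pos (this.symm ▸ J.2), if_neg (notMem_lift 0)]
  congr

theorem triHead_adjoin {n : ℕ} (g : TriCochain k B N n) (J : NonemptySubset n) :
    triHead k B N g (adjoin 0 J.1) = headMap TriDendModule.ldot n (g J) := by
  have : (Finset.univ.filter fun j : Fin n => j.succ ∈ (adjoin 0 J.1).1) = J.1 := by
    simp only [← Fin.succAbove_zero, succAbove_mem_adjoin]
    simp
  rw [triHead, dif_pos (by rw [this]; exact J.2), if_pos (mem_adjoin 0)]
  congr

theorem triLast_adjoin_empty {n : ℕ} (g : TriCochain k B N n) :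
    triLast k B N g (adjoin (Fin.last n) ∅) = ∑ J, lastMap TriDendModule.rsucc n (g J) := by
  have : ¬ (Finset.univ.filter fun j : Fin n =>
      j.castSucc ∈ (adjoin (Fin.last n) ∅).1).Nonempty := by
    simp only [← Fin.succAbove_last, succAbove_mem_adjoin]
    simp
  rw [triLast, dif_neg this]

theorem triLast_lift {n : ℕ} (g : TriCochain k B N n) (J : NonemptySubset n) :
    triLast k B N g (lift (Fin.last n) J) = lastMap TriDendModule.rprec n (g J) := by
  have : (Finset.univ.filter fun j : Fin n => j.castSucc ∈ (lift (Fin.last n) J).1) = J.1 := by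
    simp only [← Fin.succAbove_last, succAbove_mem_lift]
    simp
  rw [triLast, dif_pos (this.symm ▸ J.2), if_neg (notMem_lift _)]
  congr

theorem triLast_adjoin {n : ℕ} (g : TriCochain k B N n) (J : NonemptySubset n) :
    triLast k B N g (adjoin (Fin.last n) J.1) = lastMap TriDendModule.rdot n (g J) := by
  have : (Finset.univ.filter fun j : Fin n =>
      j.castSucc ∈ (adjoin (Fin.last n) J.1).1) = J.1 := by
    simp only [← Fin.succAbove_last, succAbove_mem_adjoin]
    simp
  rw [triLast, dif_pos (by rw [this]; exact J.2), if_pos (mem_adjoin _)]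
  congr

theorem headMap_psi_tmul {n : ℕ} (g : TriCochain k B N n) (a : Fin (n + 1) → A)
    (b : Fin (n + 1) → B) :
    headMap (tensorLeft k A B N) n (psi k A B N n g) (fun i => a i ⊗ₜ[k] b i) =
      ∑ I, pElem k a I ⊗ₜ[k] triHead k B N g I b := by
  rw [sum_eq 0, headMap_apply, psi_tmul k A g (fun j => a j.succ) (fun j => b j.succ),
    triHead_adjoin_empty, map_sum, sum_apply, TensorProduct.tmul_sum,
    ← Finset.sum_add_distrib]
  refine Finset.sum_congr rfl fun J _ => ?_
  rw [tensorLeft, tensorOp_tmul, triHead_lift, triHead_adjoin, pElem_adjoin_empty 0 a J,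
    pElem_lift, pElem_adjoin, add_assoc]
  simp only [headMap_apply, Fin.succAbove_zero]

theorem lastMap_psi_tmul {n : ℕ} (g : TriCochain k B N n) (a : Fin (n + 1) → A)
    (b : Fin (n + 1) → B) :
    lastMap (tensorRight k A B N) n (psi k A B N n g) (fun i => a i ⊗ₜ[k] b i) =
      ∑ I, pElem k a I ⊗ₜ[k] triLast k B N g I b := by
  rw [sum_eq (Fin.last n), lastMap_apply,
    psi_tmul k A g (fun j => a j.castSucc) (fun j => b j.castSucc),
    triLast_adjoin_empty, map_sum, LinearMap.sum_apply, sum_apply,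
    TensorProduct.tmul_sum, ← Finset.sum_add_distrib]
  refine Finset.sum_congr rfl fun J _ => ?_
  rw [tensorRight, tensorOp_tmul, triLast_lift, triLast_adjoin,
    pElem_adjoin_empty (Fin.last n) a J, pElem_lift, pElem_adjoin, ComTriAlgebra.bul_comm]
  simp only [lastMap_apply, Fin.succAbove_last]
  abel

variable (A B N)

theorem hochD_comp_psi (n : ℕ) :
    hochD (tensorMul k A B) (tensorLeft k A B N) (tensorRight k A B N) n ∘ₗ psi k A B N n =
      psi k A B N (n + 1) ∘ₗ triD k B N n := by
  refine LinearMap.ext fun g => MultilinearMap.ext_tmul fun a b => ?_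
  rw [LinearMap.comp_apply, LinearMap.comp_apply, psi_tmul]
  simp only [hochD, triD, LinearMap.add_apply, LinearMap.smul_apply, LinearMap.sum_apply,
    add_apply, smul_apply, sum_apply,
    headMap_psi_tmul, lastMap_psi_tmul, mergeMap_psi_tmul, LinearMap.coe_mk, AddHom.coe_mk,
    TensorProduct.tmul_add, TensorProduct.tmul_sum, TensorProduct.tmul_smul,
    Finset.sum_add_distrib, Finset.smul_sum]
  rw [Finset.sum_comm]

end Psi

/-! ### Injectivity -/

section Injectivity

/-- A commutative algebra `C` with an augmentation `ε : C → k` is a commutative tri-algebra with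
`x ∗ y = ε(y) x` and `x • y = x y`. -/
@[reducible]
def ComTriAlgebra.ofAugmentation {k : Type v} [Field k] {C : Type w} [CommRing C] [Algebra k C]
    (ε : C →ₐ[k] k) : ComTriAlgebra k C where
  ast := LinearMap.mk₂ k (fun x y => ε y • x) (fun x x' y => smul_add _ _ _)
    (fun c x y => smul_comm _ _ _) (fun x y y' => by rw [map_add, add_smul])
    (fun c x y => by rw [map_smul, smul_eq_mul, mul_smul])
  bul := LinearMap.mul k C
  ast_assoc x y z := by simp [smul_smul, mul_comm]
  ast_perm x y z := by simp [smul_smul, mul_comm]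
  bul_comm x y := by simp [mul_comm]
  bul_assoc x y z := by simp [mul_assoc]
  ast_bul x y z := by simp [smul_smul, mul_comm]
  bul_ast x y z := by simp

variable {k : Type v} [Field k] {A : Type u} [AddCommGroup A] [Module k A] [ComTriAlgebra k A]

/-- On a free commutative tri-algebra on a nonempty set there is, for every `n`, a family
`a₁, …, aₙ` such that the elements `P(a; I)` are separated by linear functionals. -/
theorem IsFreeComTri.exists_separating {X : Type w} [Nonempty X] {ι : X → A}
    (hι : IsFreeComTri k ι) (n : ℕ) :
    ∃ a : Fin n → A, ∀ I : NonemptySubset n, ∃ f : A →ₗ[k] k,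
      ∀ J, f (pElem k a J) = if J = I then 1 else 0 := by
  -- The lift only places the polynomial algebra in the universe of the test algebras; `ε` is
  -- evaluation at `1`.
  let C := ULift.{max u w} (Polynomial k)
  let ε : C →ₐ[k] k := (Polynomial.aeval (1 : k)).comp
    (ULift.algEquiv (R := k) (A := Polynomial k)).toAlgHom
  let : ComTriAlgebra k C := ComTriAlgebra.ofAugmentation ε
  obtain ⟨φ, ⟨hast, hbul, hφ⟩, -⟩ := hι C fun _ => ULift.up Polynomial.X
  obtain ⟨x⟩ := ‹Nonempty X›
  -- Repeated squaring under `•` gives elements with image `X ^ 2 ^ m`. Since `ε` takes the value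
  -- `1` on them, starred factors leave no trace in the image of `P`.
  let q : ℕ → A := Nat.rec (ι x) fun _ y => ComTriAlgebra.bul (k := k) y y
  have hq : ∀ m, φ (q m) = ULift.up (Polynomial.X ^ 2 ^ m) := by
    intro m
    induction m with
    | zero => exact (hφ x).trans (by rw [pow_zero, pow_one])
    | succ m ih =>
      change φ (ComTriAlgebra.bul (k := k) (q m) (q m)) = _
      rw [hbul, ih, pow_succ, mul_two, pow_add]
      rfl
  have hP : ∀ J : NonemptySubset n, φ (pElem k (fun i => q i) J) =
      ULift.up (Polynomial.X ^ ∑ i ∈ J.1, 2 ^ (i : ℕ)) := by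
    intro J
    rw [map_pElem φ (fun y => algebraMap k C (ε (φ y))) hbul
      (fun y z => (hast y z).trans (by
        change ε (φ z) • φ y = _
        rw [Algebra.smul_def, mul_comm]))
      (fun y z => by
        rw [hast]
        change algebraMap k C (ε (ε (φ z) • φ y)) = _
        rw [map_smul, smul_eq_mul, map_mul, mul_comm])]
    have hε : ∀ m, ε (φ (q m)) = 1 := fun m => by
      rw [hq]
      change Polynomial.aeval (1 : k) (Polynomial.X ^ 2 ^ m) = 1
      simp
    simp only [hε, map_one]
    simp only [hq]
    rw [Finset.prod_ite_mem, Finset.univ_inter, ← Finset.prod_pow_eq_pow_sum]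
    exact (map_prod (ULift.ringEquiv (R := Polynomial k)).symm _ _).symm
  refine ⟨fun i => q i, fun I => ⟨Polynomial.lcoeff k (∑ i ∈ I.1, 2 ^ (i : ℕ)) ∘ₗ
    (ULift.algEquiv (R := k) (A := Polynomial k)).toLinearMap ∘ₗ φ, fun J => ?_⟩⟩
  -- Uniqueness of binary expansions: the exponent determines the index set.
  have hinj : ∑ i ∈ I.1, 2 ^ (i : ℕ) = ∑ i ∈ J.1, 2 ^ (i : ℕ) ↔ J = I := by
    refine ⟨fun h => ?_, fun h => by rw [h]⟩
    refine Subtype.ext (Finset.map_injective Fin.valEmbedding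
      (Finset.geomSum_injective (n := 2) le_rfl ?_))
    simpa using h.symm
  rw [LinearMap.comp_apply, LinearMap.comp_apply, hP]
  change Polynomial.coeff (Polynomial.X ^ _) _ = _
  rw [Polynomial.coeff_X_pow]
  exact if_congr hinj rfl rfl

theorem psi_injective {B N : Type u} [AddCommGroup B] [Module k B]
    [AddCommGroup N] [Module k N] {X : Type w} [Nonempty X] {ι : X → A}
    (hι : IsFreeComTri k ι) (n : ℕ) : Function.Injective (psi k A B N n) := by
  rw [injective_iff_map_eq_zero]
  intro g hg
  obtain ⟨a, ha⟩ := hι.exists_separating n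
  funext I
  ext b
  obtain ⟨f, hf⟩ := ha I
  have h := psi_tmul k A g a b
  rw [hg, zero_apply] at h
  -- Applying `f ⊗ id` to the expansion of `Ψ g` isolates the coefficient `g(I; b)`.
  have h' := congrArg ((TensorProduct.lid k N).toLinearMap ∘ₗ TensorProduct.map f LinearMap.id) h
  simpa [hf, ite_smul] using h'.symm

end Injectivity

/-! ### The long exact sequence -/

section LongExact

variable {k : Type v} [Field k]

theorem quotSequence_shortExact {K L : CochainComplex (ModuleCat.{u} k) ℕ} (f : K ⟶ L)
    (hf : ∀ n, Function.Injective (f.f n).hom) : (quotSequence f).ShortExact := by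
  refine HomologicalComplex.shortExact_of_degreewise_shortExact _ fun n => ?_
  refine { exact := ?_, mono_f := ?_, epi_g := ?_ }
  · refine (ShortComplex.ShortExact.moduleCat_exact_iff_function_exact _).2 ?_
    exact LinearMap.exact_map_mkQ_range (f.f n).hom
  · exact (ModuleCat.mono_iff_injective _).2 (hf n)
  · exact (ModuleCat.epi_iff_surjective _).2 (Submodule.mkQ_surjective _)

theorem triComplex_d (B N : Type u) [AddCommGroup B] [Module k B] [TriDendriform k B]
    [AddCommGroup N] [Module k N] [TriDendModule k B N]
    (h : ∀ n, triD k B N (n + 1) ∘ₗ triD k B N n = 0) (n : ℕ) :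
    (triComplex k B N h).d n (n + 1) = ModuleCat.ofHom (triD k B N n) := by
  simp [triComplex]

theorem hochComplex_d {V W : Type u} [AddCommGroup V] [Module k V] [AddCommGroup W] [Module k W]
    (μ : V →ₗ[k] V →ₗ[k] V) (l : V →ₗ[k] W →ₗ[k] W) (r : W →ₗ[k] V →ₗ[k] W)
    (h : ∀ n, hochD μ l r (n + 1) ∘ₗ hochD μ l r n = 0) (n : ℕ) :
    (hochComplex μ l r h).d n (n + 1) = ModuleCat.ofHom (hochD μ l r n) := by
  simp [hochComplex]

end LongExact

theorem mainTheorem3 {k : Type v} [Field k] {A B N : Type u}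
    [AddCommGroup A] [Module k A] [ComTriAlgebra k A]
    [AddCommGroup B] [Module k B] [TriDendriform k B]
    [AddCommGroup N] [Module k N] [TriDendModule k B N]
    {X : Type w} [Nonempty X] (ι : X → A) (hι : IsFreeComTri k ι) :
    IsAssocBimodule (tensorMul k A B) (tensorLeft k A B N) (tensorRight k A B N) ∧
    ∃ (hT : ∀ n, triD k B N (n + 1) ∘ₗ triD k B N n = 0)
      (hH : ∀ n, hochD (tensorMul k A B) (tensorLeft k A B N) (tensorRight k A B N) (n + 1) ∘ₗ
        hochD (tensorMul k A B) (tensorLeft k A B N) (tensorRight k A B N) n = 0)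
      (Ψ : triComplex k B N hT ⟶
        hochComplex (tensorMul k A B) (tensorLeft k A B N) (tensorRight k A B N) hH),
      (∀ (n : ℕ) (g : TriCochain k B N n) (a : Fin n → A) (b : Fin n → B),
        let Ψg : MultilinearMap k (fun _ : Fin n => A ⊗[k] B) (A ⊗[k] N) := (Ψ.f n).hom g
        Ψg (fun i => a i ⊗ₜ[k] b i) =
          ∑ I : NonemptySubset n, pElem k a I ⊗ₜ[k] g I b) ∧
      (∀ n, Function.Injective (Ψ.f n).hom) ∧
      ∃ hS : (quotSequence Ψ).ShortExact,
        Function.Injective (HomologicalComplex.homologyMap Ψ 0).hom ∧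
        ∀ n : ℕ,
          Function.Exact (HomologicalComplex.homologyMap Ψ n).hom
            (HomologicalComplex.homologyMap (quotProj Ψ) n).hom ∧
          Function.Exact (HomologicalComplex.homologyMap (quotProj Ψ) n).hom
            (hS.δ n (n + 1) rfl).hom ∧
          Function.Exact (hS.δ n (n + 1) rfl).hom
            (HomologicalComplex.homologyMap Ψ (n + 1)).hom := by
  have hbi := isAssocBimodule_tensor (k := k) A B N
  have hH := fun n => hochD_comp_hochD hbi n
  have hinj := psi_injective (B := B) (N := N) hι
  have hcomm := hochD_comp_psi k A B N
  -- Apply the injective `psi` and move both differentials across it to the Hochschild side.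
  have hT : ∀ n, triD k B N (n + 1) ∘ₗ triD k B N n = 0 := fun n => by
    refine LinearMap.ext fun g => hinj (n + 2) ?_
    have h₁ := LinearMap.congr_fun (hcomm (n + 1)) (triD k B N n g)
    have h₂ := LinearMap.congr_fun (hcomm n) g
    have h₃ := LinearMap.congr_fun (hH n) (psi k A B N n g)
    simp only [LinearMap.comp_apply, LinearMap.zero_apply, map_zero] at h₁ h₂ h₃ ⊢
    rw [← h₁, ← h₂, h₃]
  let Ψ : triComplex k B N hT ⟶
      hochComplex (tensorMul k A B) (tensorLeft k A B N) (tensorRight k A B N) hH :=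
    CochainComplex.ofHom (fun n => ModuleCat.ofHom (psi k A B N n)) fun n => by
      rw [triComplex_d, hochComplex_d]
      exact congrArg ModuleCat.ofHom (hcomm n)
  have hΨ : ∀ n, Function.Injective (Ψ.f n).hom := hinj
  have hS := quotSequence_shortExact Ψ hΨ
  refine ⟨hbi, hT, hH, Ψ, fun n g a b => psi_tmul k A g a b, hΨ, hS, ?_, fun n => ⟨?_, ?_, ?_⟩⟩
  -- With no index sets in degree `0`, the cochains and hence the cohomology vanish there.
  · have : IsEmpty (NonemptySubset 0) := ⟨fun I => I.2.choose.elim0⟩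
    have h₀ : Limits.IsZero ((triComplex k B N hT).X 0) :=
      ModuleCat.isZero_of_iff_subsingleton.2
        (inferInstanceAs (Subsingleton (TriCochain k B N 0)))
    have h₁ : Limits.IsZero ((triComplex k B N hT).homology 0) :=
      ShortComplex.isZero_homology_of_isZero_X₂ _ h₀
    have := ModuleCat.subsingleton_of_isZero h₁
    exact Function.injective_of_subsingleton _
  · exact (ShortComplex.ShortExact.moduleCat_exact_iff_function_exact _).1 (hS.homology_exact₂ n)
  · exact (ShortComplex.ShortExact.moduleCat_exact_iff_function_exact _).1
      (hS.homology_exact₃ n (n + 1) rfl)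
  · exact (ShortComplex.ShortExact.moduleCat_exact_iff_function_exact _).1
      (hS.homology_exact₁ n (n + 1) rfl)
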